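/- Let $n\ge 2$ and let $X=(X_{i,j})_{1\le i<j\le n}$ be a random vector in $[0,\infty)^{\binom n2}$ whose law has a density $f$ with respect to Lebesgue measure such that $\log f$ is concave on $[0,\infty)^{\binom n2}$ (with values in $[-\infty,\infty)$) and $f$ is down-monotone, i.e. $f(x)\ge f(y)$ whenever $0\le x\le y$ coordinatewise. Assume that $X$ has negatively correlated coordinates: for all disjoint sets $I,J$ of pairs $(i,j)$ with $1\le i<j\le n$ and all nonnegative numbers $s_a$ $(a\in I)$, $t_b$ $(b\in J)$, $$\mathbb P\big(\forall a\in I\ |X_a|>s_a,\ \forall b\in J\ |X_b|>t_b\big)\le \mathbb P\big(\forall a\in I\ |X_a|>s_a\big)\,\mathbb P\big(\forall b\in J\ |X_b|>t_b\big).$$ Let $\sigma_{\min},\sigma_{\max}\ge 0$ be given by $\sigma_{\min}^2=\min_{i<j}\mathbb E X_{i,j}^2$ and $\sigma_{\max}^2=\max_{i<j}\mathbb E X_{i,j}^2$. For real $p$, let $G_{X,p}$ be the random graph on the vertices $1,\dots,n$ in which, for $i<j$, $\{i,j\}$ is an edge if and only if $X_{i,j}\le p$. Then for every $\delta\in(0,1)$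 the following hold. (a) There are positive constants $c_1,c_2$ depending only on $\delta$ such that for all $n$, $X$ as above and all $p<c_1\sigma_{\min}\frac{\log n}{n}$, $$\mathbb P(G_{X,p}\text{ has isolated vertices})>1-c_2n^{-\delta}.$$ (b) There are positive constants $C_1,C_2$ depending only on $\delta$ such that for all $n$, $X$ as above and all $p>C_1\sigma_{\max}\frac{\log n}{n}$, $$\mathbb P(G_{X,p}\text{ is connected})>1-C_2n^{-\delta}.$$ -/

import Mathlib

open MeasureTheory

noncomputable section

/-- The index set `{(i, j) : i < j}` of the unordered pairs of vertices; it has `n choose 2`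
elements. -/
abbrev VertexPair (n : ℕ) : Type := {e : Fin n × Fin n // e.1 < e.2}

/-- The nonnegative function `f` on the orthant `[0,∞)^ι` is log-concave: `log f` is concave, with
`log 0 = -∞`. -/
def LogConcaveOnOrthant {ι : Type*} (f : (ι → ℝ) → ℝ) : Prop :=
  (∀ x, 0 ≤ x → 0 ≤ f x) ∧
    ∀ x y, 0 ≤ x → 0 ≤ y → ∀ a b : ℝ, 0 < a → 0 < b → a + b = 1 →
      f x ^ a * f y ^ b ≤ f (a • x + b • y)

/-- `f` is down-monotone on the orthant `[0,∞)^ι` (for the coordinatewise order). -/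
def DownMonotoneOnOrthant {ι : Type*} (f : (ι → ℝ) → ℝ) : Prop :=
  ∀ x y, 0 ≤ x → x ≤ y → f y ≤ f x

/-- The random vector `X` takes values in `[0,∞)^ι` (almost surely) and its law has a density with
respect to Lebesgue measure which is log-concave and down-monotone on `[0,∞)^ι`. -/
def HasLogConcaveDownMonotoneDensity {Ω : Type*} [MeasurableSpace Ω] {ι : Type*} [Fintype ι]
    (P : Measure Ω) (X : Ω → ι → ℝ) : Prop :=
  AEMeasurable X P ∧
    ∃ f : (ι → ℝ) → ℝ, AEMeasurable f (volume.restrict (Set.Ici 0)) ∧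
      LogConcaveOnOrthant f ∧ DownMonotoneOnOrthant f ∧
      P.map X = (volume.restrict (Set.Ici 0)).withDensity fun x => ENNReal.ofReal (f x)

/-- Negatively correlated coordinates. -/
def NegativelyCorrelated {Ω : Type*} [MeasurableSpace Ω] {ι : Type*}
    (P : Measure Ω) (X : Ω → ι → ℝ) : Prop :=
  ∀ I J : Finset ι, Disjoint I J → ∀ s t : ι → ℝ, (∀ i ∈ I, 0 ≤ s i) → (∀ j ∈ J, 0 ≤ t j) →
    P.real {ω | (∀ i ∈ I, s i < |X ω i|) ∧ ∀ j ∈ J, t j < |X ω j|} ≤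
      P.real {ω | ∀ i ∈ I, s i < |X ω i|} * P.real {ω | ∀ j ∈ J, t j < |X ω j|}

/-- `σ_min`, the square root of the least second moment of a coordinate. -/
def sigmaMin {Ω : Type*} [MeasurableSpace Ω] {ι : Type*} (P : Measure Ω) (X : Ω → ι → ℝ) : ℝ :=
  √(⨅ e, ∫ ω, X ω e ^ 2 ∂P)

/-- `σ_max`, the square root of the largest second moment of a coordinate. -/
def sigmaMax {Ω : Type*} [MeasurableSpace Ω] {ι : Type*} (P : Measure Ω) (X : Ω → ι → ℝ) : ℝ :=
  √(⨆ e, ∫ ω, X ω e ^ 2 ∂P)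

/-- The graph on `n` vertices in which, for `i < j`, `{i, j}` is an edge iff `x (i, j) ≤ p`. -/
def thresholdGraph {n : ℕ} (x : VertexPair n → ℝ) (p : ℝ) : SimpleGraph (Fin n) :=
  SimpleGraph.fromRel fun i j => ∃ h : i < j, x ⟨(i, j), h⟩ ≤ p

/-- The graph has at least one isolated vertex. -/
def HasIsolatedVertex {V : Type*} (G : SimpleGraph V) : Prop :=
  ∃ v, G.IsIsolated v

end

/-!
By the Prékopa–Leindler inequality the marginals of the law, and its joint upper tails
`s ↦ P(∀ e, s e < X e)`, are again log-concave.

Isolated vertices: a law with a log-concave antitone density concentrates on a convex superlevel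
set of its density, and averaging shows that this set contains a multiple of the vector of medians.
Hence with `p = c t σ_min`, where `t` is of order `log n / n`, each vertex is isolated with
probability at least `exp (-2 t n) = n ^ (-(1 - δ))`. Two stars share a single pair, and
log-concavity of the tails shows that dropping one pair changes the probability that a star has no
edges only by a factor `1 - O(t (1 + t n))`. With negative correlation this makes the isolation
events almost negatively correlated, and the Chung–Erdős inequality applies.

Connectedness: log-concavity of the one-dimensional tails gives `P(s < X e) ≤ exp (-s / (4 σ_max))`.
If the graph is disconnected, some cut `(S, Sᶜ)` with `2 |S| ≤ n` has no edges; by negative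
correlation this has probability at most `y ^ |S|`, where `y = n ^ (-(1 + δ))`, and the union bound
gives `(1 + y) ^ n - 1 ≤ 2 n ^ (-δ)`.
-/

open Set
open scoped ENNReal Topology

section PrekopaLeindler

/-- Lebesgue measure on the half-line `[0,∞)`. -/
noncomputable abbrev halfLine : Measure ℝ := volume.restrict (Ici 0)

/-- Lebesgue measure on the orthant `[0,∞)^κ`, as a product measure so that it can be integrated
one coordinate at a time. -/
noncomputable abbrev orthant (κ : Type*) [Fintype κ] : Measure (κ → ℝ) :=
  Measure.pi fun _ => halfLine

/-- The hypothesis `f(x)^a g(y)^b ≤ h(a x + b y)` of the Prékopa–Leindler inequality, for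
nonnegative `x` and `y`. -/
def PrekopaLeindlerBound {E : Type*} [AddCommMonoid E] [LE E] [SMul ℝ E] (a b : ℝ)
    (f g h : E → ℝ≥0∞) : Prop :=
  ∀ ⦃x y : E⦄, 0 ≤ x → 0 ≤ y → f x ^ a * g y ^ b ≤ h (a • x + b • y)

theorem ennreal_rpow_mul_rpow_le {a b : ℝ} (ha : 0 < a) (hb : 0 < b) (hab : a + b = 1)
    (x y : ℝ≥0∞) : x ^ a * y ^ b ≤ ENNReal.ofReal a * x + ENNReal.ofReal b * y := by
  have hpq : (a⁻¹).HolderConjugate b⁻¹ :=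
    (Real.holderConjugate_iff).2 ⟨(one_lt_inv₀ ha).2 (by linarith), by simpa using hab⟩
  have h := ENNReal.young_inequality (x ^ a) (y ^ b) hpq
  rwa [← ENNReal.rpow_mul, ← ENNReal.rpow_mul, mul_inv_cancel₀ ha.ne', mul_inv_cancel₀ hb.ne',
    ENNReal.rpow_one, ENNReal.rpow_one, ENNReal.ofReal_inv_of_pos ha, ENNReal.ofReal_inv_of_pos hb,
    div_eq_mul_inv, div_eq_mul_inv, inv_inv, inv_inv, mul_comm x, mul_comm y] at h

theorem halfLine_setOf_ofReal_lt (c : ℝ≥0∞) : halfLine {l | ENNReal.ofReal l < c} = c := by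
  rw [Measure.restrict_apply' measurableSet_Ici]
  rcases eq_or_ne c ⊤ with rfl | hc
  · simp
  · have : {l | ENNReal.ofReal l < c} ∩ Ici 0 = Ico 0 c.toReal := by
      ext l
      rw [mem_inter_iff, and_comm]
      exact and_congr_right fun h0 => ENNReal.ofReal_lt_iff_lt_toReal h0 hc
    rw [this, Real.volume_Ico, sub_zero, ENNReal.ofReal_toReal hc]

theorem lintegral_eq_lintegral_measure_ofReal_lt {α : Type*} [MeasurableSpace α] (μ : Measure α)
    [SFinite μ] {u : α → ℝ≥0∞} (hu : Measurable u) :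
    ∫⁻ x, u x ∂μ = ∫⁻ l, μ {x | ENNReal.ofReal l < u x} ∂halfLine := by
  have hm : MeasurableSet {q : α × ℝ | ENNReal.ofReal q.2 < u q.1} :=
    measurableSet_lt (ENNReal.measurable_ofReal.comp measurable_snd) (hu.comp measurable_fst)
  calc ∫⁻ x, u x ∂μ
      = ∫⁻ x, halfLine (Prod.mk x ⁻¹' {q : α × ℝ | ENNReal.ofReal q.2 < u q.1}) ∂μ :=
        lintegral_congr fun x => (halfLine_setOf_ofReal_lt (u x)).symm
    _ = (μ.prod halfLine) {q : α × ℝ | ENNReal.ofReal q.2 < u q.1} := (Measure.prod_apply hm).symm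
    _ = _ := Measure.prod_apply_symm hm

theorem halfLine_le_iSup_ofReal (U : Set ℝ) :
    halfLine U ≤ ⨆ s ∈ U ∩ Ici 0, ENNReal.ofReal s := by
  rcases eq_or_ne (⨆ s ∈ U ∩ Ici 0, ENNReal.ofReal s) ⊤ with h | h
  · exact h ▸ le_top
  · have hsub : U ∩ Ici 0 ⊆ Icc 0 (⨆ s ∈ U ∩ Ici 0, ENNReal.ofReal s).toReal := fun s hs =>
      ⟨hs.2, (ENNReal.ofReal_le_iff_le_toReal h).1
        (le_iSup₂ (f := fun s (_ : s ∈ U ∩ Ici 0) => ENNReal.ofReal s) s hs)⟩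
    rw [Measure.restrict_apply' measurableSet_Ici]
    refine (measure_mono hsub).trans ?_
    rw [Real.volume_Icc, sub_zero, ENNReal.ofReal_toReal h]

theorem brunnMinkowski_halfLine {a b : ℝ} (ha : 0 < a) (hb : 0 < b) {U V W : Set ℝ}
    (hU : (U ∩ Ici 0).Nonempty) (hV : (V ∩ Ici 0).Nonempty) (hW : IsLowerSet W)
    (h : ∀ s ∈ U ∩ Ici 0, ∀ t ∈ V ∩ Ici 0, a * s + b * t ∈ W) :
    ENNReal.ofReal a * halfLine U + ENNReal.ofReal b * halfLine V ≤ halfLine W := by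
  refine (add_le_add (mul_le_mul_right (halfLine_le_iSup_ofReal U) _)
    (mul_le_mul_right (halfLine_le_iSup_ofReal V) _)).trans ?_
  simp_rw [ENNReal.mul_iSup]
  refine ENNReal.biSup_add_biSup_le' (p := fun s => s ∈ U ∩ Ici 0) (q := fun t => t ∈ V ∩ Ici 0)
    hU hV fun s hs t ht => ?_
  have hs0 : 0 ≤ s := hs.2
  have ht0 : 0 ≤ t := ht.2
  have hsub : Icc 0 (a * s + b * t) ⊆ W ∩ Ici 0 := fun r hr => ⟨hW hr.2 (h s hs t ht), hr.1⟩
  rw [← ENNReal.ofReal_mul ha.le, ← ENNReal.ofReal_mul hb.le,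
    ← ENNReal.ofReal_add (by positivity) (by positivity),
    Measure.restrict_apply' measurableSet_Ici]
  calc ENNReal.ofReal (a * s + b * t) = volume (Icc 0 (a * s + b * t)) := by
        rw [Real.volume_Icc, sub_zero]
    _ ≤ volume (W ∩ Ici 0) := measure_mono hsub

variable {a b : ℝ} {u v w : ℝ → ℝ≥0∞}

theorem halfLine_setOf_lt_eq_zero (hu : Antitone u) {c : ℝ≥0∞} (hc : u 0 ≤ c) :
    halfLine {x | c < u x} = 0 := by
  rw [Measure.restrict_apply' measurableSet_Ici]
  have : {x | c < u x} ∩ Ici 0 = ∅ :=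
    eq_empty_of_forall_notMem fun x hx => (hx.1.trans_le ((hu hx.2).trans hc)).false
  rw [this, measure_empty]

theorem ofReal_mul_lintegral_halfLine_add_le (ha : 0 < a) (hb : 0 < b) (hab : a + b = 1)
    (hu : Antitone u) (hv : Antitone v) (hw : Antitone w) (hu0 : u 0 = 1) (hv0 : v 0 = 1)
    (h : PrekopaLeindlerBound a b u v w) :
    ENNReal.ofReal a * ∫⁻ s, u s ∂halfLine + ENNReal.ofReal b * ∫⁻ s, v s ∂halfLine
      ≤ ∫⁻ s, w s ∂halfLine := by
  have hmeas (u : ℝ → ℝ≥0∞) : Measurable fun l : ℝ => halfLine {x | ENNReal.ofReal l < u x} :=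
    Antitone.measurable fun l l' hl =>
      measure_mono fun x hx => (ENNReal.ofReal_le_ofReal hl).trans_lt hx
  rw [lintegral_eq_lintegral_measure_ofReal_lt _ hu.measurable,
    lintegral_eq_lintegral_measure_ofReal_lt _ hv.measurable,
    lintegral_eq_lintegral_measure_ofReal_lt _ hw.measurable,
    ← lintegral_const_mul _ (hmeas u), ← lintegral_const_mul _ (hmeas v),
    ← lintegral_add_left ((hmeas u).const_mul _)]
  refine lintegral_mono fun l => ?_
  rcases lt_or_ge (ENNReal.ofReal l) 1 with hl | hl
  · refine brunnMinkowski_halfLine ha hb ⟨0, hl.trans_eq hu0.symm, self_mem_Ici⟩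
      ⟨0, hl.trans_eq hv0.symm, self_mem_Ici⟩ (fun x y hyx hx => hx.trans_le (hw hyx))
      fun s hs t ht => ?_
    calc ENNReal.ofReal l = ENNReal.ofReal l ^ a * ENNReal.ofReal l ^ b := by
          rw [← ENNReal.rpow_add_of_nonneg _ _ ha.le hb.le, hab, ENNReal.rpow_one]
      _ < u s ^ a * v t ^ b :=
          ENNReal.mul_lt_mul (ENNReal.rpow_lt_rpow hs.1 ha) (ENNReal.rpow_lt_rpow ht.1 hb)
      _ ≤ w (a * s + b * t) := h hs.2 ht.2
  · simp [halfLine_setOf_lt_eq_zero hu (hu0.trans_le hl),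
      halfLine_setOf_lt_eq_zero hv (hv0.trans_le hl)]

/- Dividing `u` and `v` by their values at `0` makes their superlevel sets nonempty for the same
levels, so that the additive form applies; the geometric mean then undoes the normalisation. -/
theorem prekopaLeindler_halfLine_of_apply_zero (ha : 0 < a) (hb : 0 < b) (hab : a + b = 1)
    (hu : Antitone u) (hv : Antitone v) (hw : Antitone w) (hu0 : u 0 ≠ 0) (hu0' : u 0 ≠ ⊤)
    (hv0 : v 0 ≠ 0) (hv0' : v 0 ≠ ⊤) (h : PrekopaLeindlerBound a b u v w) :
    (∫⁻ s, u s ∂halfLine) ^ a * (∫⁻ s, v s ∂halfLine) ^ b ≤ ∫⁻ s, w s ∂halfLine := by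
  set M := (u 0)⁻¹ ^ a * (v 0)⁻¹ ^ b
  have hM0 : M ≠ 0 := mul_ne_zero
    (ENNReal.rpow_pos (by simpa using hu0') (by simpa using hu0)).ne'
    (ENNReal.rpow_pos (by simpa using hv0') (by simpa using hv0)).ne'
  have hM : M ≠ ⊤ := ENNReal.mul_ne_top (ENNReal.rpow_ne_top_of_nonneg ha.le (by simpa using hu0))
    (ENNReal.rpow_ne_top_of_nonneg hb.le (by simpa using hv0))
  have hscale {f : ℝ → ℝ≥0∞} (c : ℝ≥0∞) (hf : Antitone f) : Antitone fun s => c * f s :=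
    fun s t hst => mul_le_mul_right (hf hst) c
  have hbound : PrekopaLeindlerBound a b (fun s => (u 0)⁻¹ * u s) (fun s => (v 0)⁻¹ * v s)
      fun s => M * w s := fun s t hs ht => by
    rw [ENNReal.mul_rpow_of_nonneg _ _ ha.le, ENNReal.mul_rpow_of_nonneg _ _ hb.le,
      mul_mul_mul_comm]
    exact mul_le_mul_right (h hs ht) _
  have hsum := ofReal_mul_lintegral_halfLine_add_le ha hb hab (hscale _ hu) (hscale _ hv)
    (hscale _ hw) (ENNReal.inv_mul_cancel hu0 hu0') (ENNReal.inv_mul_cancel hv0 hv0') hbound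
  have hprod := (ennreal_rpow_mul_rpow_le ha hb hab _ _).trans hsum
  rwa [lintegral_const_mul _ hu.measurable, lintegral_const_mul _ hv.measurable,
    lintegral_const_mul _ hw.measurable, ENNReal.mul_rpow_of_nonneg _ _ ha.le,
    ENNReal.mul_rpow_of_nonneg _ _ hb.le, mul_mul_mul_comm,
    ENNReal.mul_le_mul_iff_right hM0 hM] at hprod

theorem lintegral_halfLine_eq_top (hw : Antitone w) {t : ℝ} (ht : 0 < t) (h : w t = ⊤) :
    ∫⁻ s, w s ∂halfLine = ⊤ := by
  have hle : ∫⁻ _ in Icc 0 t, (⊤ : ℝ≥0∞) ≤ ∫⁻ s, w s ∂halfLine :=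
    calc ∫⁻ _ in Icc 0 t, (⊤ : ℝ≥0∞) ≤ ∫⁻ s in Icc 0 t, w s :=
          setLIntegral_mono' measurableSet_Icc fun s hs => h ▸ hw hs.2
      _ ≤ _ := lintegral_mono' (Measure.restrict_mono Icc_subset_Ici_self le_rfl) le_rfl
  simpa [lintegral_const, ht] using hle

theorem exists_pos_apply_ne_zero_of_lintegral_halfLine_ne_zero
    (h : ∫⁻ s, v s ∂halfLine ≠ 0) : ∃ t, 0 < t ∧ v t ≠ 0 := by
  by_contra! hv
  refine h ?_
  rw [halfLine, ← restrict_Ioi_eq_restrict_Ici]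
  exact setLIntegral_eq_zero measurableSet_Ioi hv

theorem prekopaLeindler_halfLine (ha : 0 < a) (hb : 0 < b) (hab : a + b = 1)
    (hu : Antitone u) (hv : Antitone v) (hw : Antitone w) (h : PrekopaLeindlerBound a b u v w) :
    (∫⁻ s, u s ∂halfLine) ^ a * (∫⁻ s, v s ∂halfLine) ^ b ≤ ∫⁻ s, w s ∂halfLine := by
  rcases eq_or_ne (∫⁻ s, u s ∂halfLine) 0 with hIu | hIu
  · simp [hIu, ha]
  rcases eq_or_ne (∫⁻ s, v s ∂halfLine) 0 with hIv | hIv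
  · simp [hIv, hb]
  obtain ⟨s, hs, hus⟩ := exists_pos_apply_ne_zero_of_lintegral_halfLine_ne_zero hIu
  obtain ⟨t, ht, hvt⟩ := exists_pos_apply_ne_zero_of_lintegral_halfLine_ne_zero hIv
  have hu0 : u 0 ≠ 0 := (hus.bot_lt.trans_le (hu hs.le)).ne'
  have hv0 : v 0 ≠ 0 := (hvt.bot_lt.trans_le (hv ht.le)).ne'
  have htop : (∃ r, 0 < r ∧ w r = ⊤) →
      (∫⁻ s, u s ∂halfLine) ^ a * (∫⁻ s, v s ∂halfLine) ^ b ≤ ∫⁻ s, w s ∂halfLine :=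
    fun ⟨r, hr, hwr⟩ => le_top.trans_eq (lintegral_halfLine_eq_top hw hr hwr).symm
  rcases eq_or_ne (u 0) ⊤ with hu0' | hu0'
  · refine htop ⟨a • 0 + b • t, by simpa using mul_pos hb ht, top_le_iff.1 ?_⟩
    refine le_of_eq_of_le ?_ (h le_rfl ht.le)
    rw [hu0', ENNReal.top_rpow_of_pos ha, ENNReal.top_mul]
    simp [hvt, hb.le]
  rcases eq_or_ne (v 0) ⊤ with hv0' | hv0'
  · refine htop ⟨a • s + b • 0, by simpa using mul_pos ha hs, top_le_iff.1 ?_⟩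
    refine le_of_eq_of_le ?_ (h hs.le le_rfl)
    rw [hv0', ENNReal.top_rpow_of_pos hb, ENNReal.mul_top]
    simp [hus, ha.le]
  exact prekopaLeindler_halfLine_of_apply_zero ha hb hab hu hv hw hu0 hu0' hv0 hv0' h

variable {κ : Type*}

theorem antitone_lmarginal [DecidableEq κ] {μ : κ → Measure ℝ} {f : (κ → ℝ) → ℝ≥0∞}
    (hf : Antitone f) (s : Finset κ) : Antitone (lmarginal μ s f) := by
  refine fun x y hxy => lintegral_mono fun z => hf fun i => ?_
  by_cases hi : i ∈ s
  · simp [Function.updateFinset, hi]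
  · simpa [Function.updateFinset, hi] using hxy i

theorem zero_le_update [DecidableEq κ] {x : κ → ℝ} {i : κ} {r : ℝ} (hx : 0 ≤ x) (hr : 0 ≤ r) :
    0 ≤ Function.update x i r :=
  le_update_iff.2 ⟨hr, fun j _ => hx j⟩

theorem PrekopaLeindlerBound.lmarginal_halfLine [DecidableEq κ] (ha : 0 < a) (hb : 0 < b)
    (hab : a + b = 1) {f g h : (κ → ℝ) → ℝ≥0∞} (hf : Measurable f) (hg : Measurable g)
    (hh : Measurable h) (hfa : Antitone f) (hga : Antitone g) (hha : Antitone h)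
    (H : PrekopaLeindlerBound a b f g h) (s : Finset κ) :
    PrekopaLeindlerBound a b (lmarginal (fun _ => halfLine) s f)
      (lmarginal (fun _ => halfLine) s g) (lmarginal (fun _ => halfLine) s h) := by
  induction s using Finset.induction_on with
  | empty => simpa only [lmarginal_empty] using H
  | insert i s hi ih =>
    intro x y hx hy
    rw [lmarginal_insert f hf hi, lmarginal_insert g hg hi, lmarginal_insert h hh hi]
    have hanti {f : (κ → ℝ) → ℝ≥0∞} (hf : Antitone f) (x : κ → ℝ) :
        Antitone fun r => lmarginal (fun _ => halfLine) s f (Function.update x i r) :=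
      fun p q hpq => antitone_lmarginal hf s (update_le_update_iff.2 ⟨hpq, fun _ _ => le_rfl⟩)
    refine prekopaLeindler_halfLine ha hb hab (hanti hfa x) (hanti hga y)
      (hanti hha (a • x + b • y)) fun p q hp hq => ?_
    simpa only [← Function.update_smul, ← Function.update_add] using
      ih (zero_le_update (i := i) hx hp) (zero_le_update (i := i) hy hq)

theorem prekopaLeindler_orthant [Fintype κ] (ha : 0 < a) (hb : 0 < b) (hab : a + b = 1)
    {f g h : (κ → ℝ) → ℝ≥0∞} (hf : Measurable f) (hg : Measurable g) (hh : Measurable h)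
    (hfa : Antitone f) (hga : Antitone g) (hha : Antitone h) (H : PrekopaLeindlerBound a b f g h) :
    (∫⁻ x, f x ∂orthant κ) ^ a * (∫⁻ x, g x ∂orthant κ) ^ b ≤ ∫⁻ x, h x ∂orthant κ := by
  classical
  simpa only [lmarginal_univ] using
    H.lmarginal_halfLine ha hb hab hf hg hh hfa hga hha Finset.univ (le_refl 0) (le_refl 0)

end PrekopaLeindler

section Law

variable {κ : Type*}

/-- A measurable, antitone function that is log-concave on the orthant. -/
structure LogConcaveAntitone (F : (κ → ℝ) → ℝ≥0∞) : Prop where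
  measurable : Measurable F
  antitone : Antitone F
  logConcave ⦃a b : ℝ⦄ : 0 < a → 0 < b → a + b = 1 → PrekopaLeindlerBound a b F F F

/-- The largest lower semicontinuous minorant of an antitone function; unlike the function itself,
it is Borel measurable. -/
noncomputable def lscHull (g : (κ → ℝ) → ℝ≥0∞) (x : κ → ℝ) : ℝ≥0∞ :=
  ⨆ y : {y : κ → ℝ // ∀ i, x i < y i}, g y

theorem lscHull_antitone (g : (κ → ℝ) → ℝ≥0∞) : Antitone (lscHull g) := fun x _ hx =>
  iSup_le fun y => le_iSup (fun y : {y : κ → ℝ // ∀ i, x i < y i} => g y)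
    ⟨y, fun i => (hx i).trans_lt (y.2 i)⟩

theorem lscHull_le {g : (κ → ℝ) → ℝ≥0∞} (hg : Antitone g) : lscHull g ≤ g := fun _ =>
  iSup_le fun y => hg fun i => (y.2 i).le

theorem logConcave_lscHull {a b : ℝ} (ha : 0 < a) (hb : 0 < b)
    {g : (κ → ℝ) → ℝ≥0∞} (hg : PrekopaLeindlerBound a b g g g) :
    PrekopaLeindlerBound a b (lscHull g) (lscHull g) (lscHull g) := by
  intro x x' hx hx'
  have hrpow {c : ℝ} (hc : 0 < c) (x : κ → ℝ) :
      lscHull g x ^ c = ⨆ y : {y : κ → ℝ // ∀ i, x i < y i}, g y ^ c :=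
    (ENNReal.orderIsoRpow c hc).map_iSup _
  simp only [hrpow ha, hrpow hb, ENNReal.iSup_mul, ENNReal.mul_iSup]
  refine iSup_le fun y' => iSup_le fun y => ?_
  have hy : 0 ≤ y.1 := fun i => (hx i).trans (y.2 i).le
  have hy' : 0 ≤ y'.1 := fun i => (hx' i).trans (y'.2 i).le
  refine (hg hy hy').trans (le_iSup (fun y : {y : κ → ℝ // ∀ i, (a • x + b • x') i < y i} => g y)
    ⟨a • y.1 + b • y'.1, fun i => ?_⟩)
  exact add_lt_add (mul_lt_mul_of_pos_left (y.2 i) ha) (mul_lt_mul_of_pos_left (y'.2 i) hb)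

theorem isOpen_setOf_forall_lt [Finite κ] (y : κ → ℝ) : IsOpen {x : κ → ℝ | ∀ i, x i < y i} := by
  simp only [ofPred_forall]
  exact isOpen_iInter_of_finite fun i => isOpen_lt (continuous_apply i) continuous_const

theorem isOpen_setOf_forall_gt [Finite κ] (x : κ → ℝ) : IsOpen {y : κ → ℝ | ∀ i, x i < y i} := by
  simp only [ofPred_forall]
  exact isOpen_iInter_of_finite fun i => isOpen_lt continuous_const (continuous_apply i)

theorem measurable_lscHull [Finite κ] (g : (κ → ℝ) → ℝ≥0∞) : Measurable (lscHull g) := by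
  refine measurable_of_Ioi fun l => ?_
  have : lscHull g ⁻¹' Ioi l = ⋃ y ∈ {y | l < g y}, {x | ∀ i, x i < y i} := by
    ext x
    simp [lscHull, lt_iSup_iff, and_comm]
  rw [this]
  exact (isOpen_biUnion fun y _ => isOpen_setOf_forall_lt y).measurableSet

theorem exists_forall_lt_mem_of_mem_nhds {x : κ → ℝ} {s : Set (κ → ℝ)} (hs : s ∈ 𝓝 x) :
    ∃ y ∈ s, ∀ i, x i < y i := by
  have hlim : Filter.Tendsto (fun c : ℝ => x + fun _ => c) (𝓝[>] 0) (𝓝 x) := by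
    refine Filter.Tendsto.mono_left ?_ nhdsWithin_le_nhds
    exact Continuous.tendsto' (by fun_prop) _ _ (by ext; simp)
  obtain ⟨c, hc, hc0⟩ := ((hlim.eventually hs).and self_mem_nhdsWithin).exists
  exact ⟨_, hc, fun i => lt_add_of_pos_right _ hc0⟩

theorem lscHull_ae_eq [Fintype κ] {g : (κ → ℝ) → ℝ≥0∞} (hg : Antitone g) :
    lscHull g =ᵐ[volume] g := by
  have hfrontier : ∀ᵐ x : κ → ℝ, ∀ q : ℚ, x ∉ frontier {x | (Real.toNNReal q : ℝ≥0∞) < g x} :=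
    ae_all_iff.2 fun q => measure_eq_zero_iff_ae_notMem.1
      (IsLowerSet.null_frontier fun x y hyx hx => lt_of_lt_of_le hx (hg hyx))
  filter_upwards [hfrontier] with x hx
  refine le_antisymm (lscHull_le hg x) (le_of_forall_lt fun l hl => ?_)
  obtain ⟨q, -, hlq, hq⟩ := ENNReal.lt_iff_exists_rat_btwn.1 hl
  have hint : x ∈ interior {x | (Real.toNNReal q : ℝ≥0∞) < g x} :=
    not_not.1 fun hx' => hx q ⟨subset_closure hq, hx'⟩
  obtain ⟨y, hy, hxy⟩ := exists_forall_lt_mem_of_mem_nhds (mem_interior_iff_mem_nhds.1 hint)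
  exact (hlq.trans hy).trans_le (le_iSup (fun y : {y : κ → ℝ // ∀ i, x i < y i} => g y) ⟨y, hxy⟩)

theorem orthant_eq_restrict (κ : Type*) [Fintype κ] : orthant κ = volume.restrict (Ici 0) := by
  rw [volume_pi, ← pi_univ_Ici, Measure.restrict_pi_pi]
  rfl

theorem exists_logConcaveAntitone_ae_eq [Fintype κ] {f : (κ → ℝ) → ℝ}
    (hf : LogConcaveOnOrthant f) (hm : DownMonotoneOnOrthant f) :
    ∃ F : (κ → ℝ) → ℝ≥0∞, LogConcaveAntitone F ∧
      F =ᵐ[orthant κ] fun x => ENNReal.ofReal (f x) := by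
  set g : (κ → ℝ) → ℝ≥0∞ := fun x => ENNReal.ofReal (f (x ⊔ 0))
  have hg : Antitone g := fun _ _ h =>
    ENNReal.ofReal_le_ofReal (hm _ _ le_sup_right (sup_le_sup_right h 0))
  have hgf {x : κ → ℝ} (hx : 0 ≤ x) : g x = ENNReal.ofReal (f x) := by
    simp only [g, sup_eq_left.2 hx]
  refine ⟨lscHull g, ⟨measurable_lscHull g, lscHull_antitone g, fun a b ha hb hab =>
    logConcave_lscHull ha hb fun x y hx hy => ?_⟩, ?_⟩
  · rw [hgf hx, hgf hy, hgf (add_nonneg (smul_nonneg ha.le hx) (smul_nonneg hb.le hy)),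
      ENNReal.ofReal_rpow_of_nonneg (hf.1 x hx) ha.le,
      ENNReal.ofReal_rpow_of_nonneg (hf.1 y hy) hb.le,
      ← ENNReal.ofReal_mul (Real.rpow_nonneg (hf.1 x hx) a)]
    exact ENNReal.ofReal_le_ofReal (hf.2 x y hx hy a b ha hb hab)
  · rw [orthant_eq_restrict]
    filter_upwards [ae_restrict_of_ae (lscHull_ae_eq hg), ae_restrict_mem measurableSet_Ici]
      with x hx hx0
    rw [hx, hgf hx0]

theorem rpow_half_mul_self (a : ℝ≥0∞) : a ^ (1 / 2 : ℝ) * a ^ (1 / 2 : ℝ) = a := by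
  rw [← ENNReal.rpow_add_of_nonneg _ _ one_half_pos.le one_half_pos.le, add_halves,
    ENNReal.rpow_one]

theorem sq_mul_rpow_half (ε a : ℝ≥0∞) : (ε ^ 2 * a) ^ (1 / 2 : ℝ) = ε * a ^ (1 / 2 : ℝ) := by
  rw [ENNReal.mul_rpow_of_nonneg _ _ one_half_pos.le, ← ENNReal.rpow_two, ← ENNReal.rpow_mul]
  norm_num

namespace LogConcaveAntitone

variable {F : (κ → ℝ) → ℝ≥0∞} {ε : ℝ≥0∞}

theorem sqrt_mul_sqrt_le (hF : LogConcaveAntitone F) {x y : κ → ℝ} (hx : 0 ≤ x) (hy : 0 ≤ y) :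
    F x ^ (1 / 2 : ℝ) * F y ^ (1 / 2 : ℝ) ≤ F ((1 / 2 : ℝ) • x + (1 / 2 : ℝ) • y) :=
  hF.logConcave one_half_pos one_half_pos (add_halves 1) hx hy

theorem le_apply_half_smul (hF : LogConcaveAntitone F) {x : κ → ℝ} (hx : 0 ≤ x)
    (hε : F x ≤ ε ^ 2 * F 0) : F x ≤ ε * F ((1 / 2 : ℝ) • x) :=
  calc F x = F x ^ (1 / 2 : ℝ) * F x ^ (1 / 2 : ℝ) := (rpow_half_mul_self _).symm
    _ ≤ F x ^ (1 / 2 : ℝ) * (ε ^ 2 * F 0) ^ (1 / 2 : ℝ) := by gcongr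
    _ = ε * (F x ^ (1 / 2 : ℝ) * F 0 ^ (1 / 2 : ℝ)) := by rw [sq_mul_rpow_half, mul_left_comm]
    _ ≤ ε * F ((1 / 2 : ℝ) • x) := by
        simpa using mul_le_mul_right (hF.sqrt_mul_sqrt_le hx le_rfl) ε

theorem mul_apply_le_apply_half_smul_add (hF : LogConcaveAntitone F) {x y : κ → ℝ} (hx : 0 ≤ x)
    (hy : 0 ≤ y) (hε : ε ^ 2 * F 0 ≤ F x) :
    ε * F y ≤ F ((1 / 2 : ℝ) • x + (1 / 2 : ℝ) • y) :=
  calc ε * F y = ε * (F y ^ (1 / 2 : ℝ) * F y ^ (1 / 2 : ℝ)) := by rw [rpow_half_mul_self]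
    _ ≤ ε * (F 0 ^ (1 / 2 : ℝ) * F y ^ (1 / 2 : ℝ)) := by
        gcongr
        exact hF.antitone hy
    _ = (ε ^ 2 * F 0) ^ (1 / 2 : ℝ) * F y ^ (1 / 2 : ℝ) := by rw [sq_mul_rpow_half, mul_assoc]
    _ ≤ F x ^ (1 / 2 : ℝ) * F y ^ (1 / 2 : ℝ) := by gcongr
    _ ≤ F ((1 / 2 : ℝ) • x + (1 / 2 : ℝ) • y) := hF.sqrt_mul_sqrt_le hx hy

theorem convex_setOf_le (hF : LogConcaveAntitone F) (C : ℝ≥0∞) :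
    Convex ℝ {x | 0 ≤ x ∧ C ≤ F x} := by
  refine convex_iff_forall_pos.2 fun x hx y hy a b ha hb hab =>
    ⟨add_nonneg (smul_nonneg ha.le hx.1) (smul_nonneg hb.le hy.1), ?_⟩
  calc C = C ^ a * C ^ b := by
        rw [← ENNReal.rpow_add_of_nonneg _ _ ha.le hb.le, hab, ENNReal.rpow_one]
    _ ≤ F x ^ a * F y ^ b :=
        mul_le_mul' (ENNReal.rpow_le_rpow hx.2 ha.le) (ENNReal.rpow_le_rpow hy.2 hb.le)
    _ ≤ F (a • x + b • y) := hF.logConcave ha hb hab hx.1 hy.1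

end LogConcaveAntitone

theorem measureReal_le_eq_one_sub {Q : Measure (κ → ℝ)} [IsProbabilityMeasure Q] (e : κ) (r : ℝ) :
    Q.real {x | x e ≤ r} = 1 - Q.real {x | r < x e} := by
  rw [← probReal_compl_eq_one_sub (measurableSet_lt measurable_const (measurable_pi_apply e))]
  congr 1 with x
  simp

variable [Fintype κ] {Q : Measure (κ → ℝ)}

/-- `Q` is supported by the orthant and has a log-concave antitone density there. -/
def LogConcaveAntitoneLaw (Q : Measure (κ → ℝ)) : Prop :=
  ∃ F : (κ → ℝ) → ℝ≥0∞, LogConcaveAntitone F ∧ Q = (orthant κ).withDensity F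

theorem HasLogConcaveDownMonotoneDensity.logConcaveAntitoneLaw_map {Ω : Type*} [MeasurableSpace Ω]
    {P : Measure Ω} {X : Ω → κ → ℝ} (h : HasLogConcaveDownMonotoneDensity P X) :
    LogConcaveAntitoneLaw (P.map X) := by
  obtain ⟨-, f, -, hlc, hdm, hmap⟩ := h
  obtain ⟨F, hF, hFf⟩ := exists_logConcaveAntitone_ae_eq hlc hdm
  exact ⟨F, hF, by rw [hmap, withDensity_congr_ae hFf, orthant_eq_restrict]⟩

theorem map_fst_withDensity {α β γ : Type*} [MeasurableSpace α] [MeasurableSpace β]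
    [MeasurableSpace γ] {ρ : Measure α} {μ : Measure β} {ν : Measure γ} [SFinite μ] [SFinite ν]
    (e : α ≃ᵐ β × γ) (he : MeasurePreserving e ρ (μ.prod ν)) {F : α → ℝ≥0∞} (hF : Measurable F) :
    (ρ.withDensity F).map (fun z => (e z).1) =
      μ.withDensity fun x => ∫⁻ y, F (e.symm (x, y)) ∂ν := by
  have hfst : Measurable fun z => (e z).1 := measurable_fst.comp e.measurable
  ext A hA
  rw [Measure.map_apply hfst hA, withDensity_apply _ (hfst hA), withDensity_apply _ hA]
  calc ∫⁻ z in (fun z => (e z).1) ⁻¹' A, F z ∂ρ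
      = ∫⁻ z in e ⁻¹' (A ×ˢ univ), F (e.symm (e z)) ∂ρ := by
        simp only [prod_univ, MeasurableEquiv.symm_apply_apply]; rfl
    _ = ∫⁻ q in A ×ˢ univ, F (e.symm q) ∂μ.prod ν :=
        he.setLIntegral_comp_preimage_emb e.measurableEmbedding (fun q => F (e.symm q)) _
    _ = ∫⁻ x in A, ∫⁻ y, F (e.symm (x, y)) ∂ν ∂μ := by
        rw [setLIntegral_prod (fun q => F (e.symm q)) (hF.comp e.symm.measurable).aemeasurable]
        simp only [Measure.restrict_univ]

theorem LogConcaveAntitone.marginal {F : (κ → ℝ) → ℝ≥0∞} (hF : LogConcaveAntitone F)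
    (p : κ → Prop) [DecidablePred p] :
    LogConcaveAntitone fun x : {i // p i} → ℝ =>
      ∫⁻ y, F ((MeasurableEquiv.piEquivPiSubtypeProd (fun _ => ℝ) p).symm (x, y))
        ∂orthant {i // ¬ p i} := by
  set e := MeasurableEquiv.piEquivPiSubtypeProd (fun _ : κ => ℝ) p
  have happly (x y i) : e.symm (x, y) i = if h : p i then x ⟨i, h⟩ else y ⟨i, h⟩ := rfl
  have hmono {x x' y y'} (hx : x ≤ x') (hy : y ≤ y') : e.symm (x, y) ≤ e.symm (x', y') := by
    intro i
    rw [happly, happly]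
    split_ifs
    exacts [hx _, hy _]
  have hadd (a b : ℝ) (x x' y y') : e.symm (a • x + b • x', a • y + b • y') =
      a • e.symm (x, y) + b • e.symm (x', y') := by
    ext i
    simp only [Pi.add_apply, Pi.smul_apply, happly]
    split_ifs <;> rfl
  have hzero : e.symm (0, 0) = 0 := by
    ext i
    rw [happly]
    split_ifs <;> rfl
  have hmeas : Measurable fun q => F (e.symm q) := hF.measurable.comp e.symm.measurable
  have hanti (x) : Antitone fun y => F (e.symm (x, y)) := fun _ _ h => hF.antitone (hmono le_rfl h)
  refine ⟨hmeas.lintegral_prod_right', fun x x' h => lintegral_mono fun y =>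
    hF.antitone (hmono h le_rfl), fun a b ha hb hab x x' hx hx' => ?_⟩
  refine prekopaLeindler_orthant ha hb hab (hmeas.comp (by fun_prop)) (hmeas.comp (by fun_prop))
    (hmeas.comp (by fun_prop)) (hanti _) (hanti _) (hanti _) fun y y' hy hy' => ?_
  rw [hadd]
  exact hF.logConcave ha hb hab (hzero ▸ hmono hx hy) (hzero ▸ hmono hx' hy')

theorem LogConcaveAntitoneLaw.map_subtype (hQ : LogConcaveAntitoneLaw Q) (p : κ → Prop)
    [inst : Fintype {i // p i}] : LogConcaveAntitoneLaw (Q.map fun x (i : {i // p i}) => x i) := by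
  classical
  obtain rfl : inst = Subtype.fintype p := Subsingleton.elim _ _
  obtain ⟨F, hF, rfl⟩ := hQ
  exact ⟨_, hF.marginal p, map_fst_withDensity _
    (measurePreserving_piEquivPiSubtypeProd (fun _ : κ => halfLine) p) hF.measurable⟩

theorem orthant_setOf_lt_ae_eq_Ici (x : κ → ℝ) : {y | ∀ i, x i < y i} =ᵐ[orthant κ] Ici x := by
  have hne : ∀ᵐ y ∂orthant κ, ∀ i, y i ≠ x i := by
    refine ae_all_iff.2 fun i => ?_
    exact (Measure.quasiMeasurePreserving_eval (fun _ : κ => halfLine) i).ae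
      (ae_restrict_of_ae (Measure.ae_ne volume (x i)))
  filter_upwards [hne] with y hy
  exact propext ⟨fun h i => (h i).le, fun h i => lt_of_le_of_ne (h i) (hy i).symm⟩

theorem ae_orthant_pos (κ : Type*) [Fintype κ] : ∀ᵐ x ∂orthant κ, ∀ i, 0 < x i := by
  have hnonneg : ∀ᵐ x ∂orthant κ, x ∈ Ici 0 := by
    rw [orthant_eq_restrict]
    exact ae_restrict_mem measurableSet_Ici
  filter_upwards [hnonneg, orthant_setOf_lt_ae_eq_Ici (0 : κ → ℝ)] with x hx hiff
  exact hiff.mpr hx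

theorem ae_orthant_nonneg (κ : Type*) [Fintype κ] : ∀ᵐ x ∂orthant κ, 0 ≤ x :=
  (ae_orthant_pos κ).mono fun _ hx i => (hx i).le

theorem setLIntegral_orthant_Ici (F : (κ → ℝ) → ℝ≥0∞) {x : κ → ℝ} (hx : 0 ≤ x) :
    ∫⁻ y in Ici x, F y ∂orthant κ = ∫⁻ y, F (x + y) ∂orthant κ := by
  rw [orthant_eq_restrict, Measure.restrict_restrict measurableSet_Ici,
    inter_eq_left.2 (Ici_subset_Ici.2 hx),
    ← (measurePreserving_add_left volume x).setLIntegral_comp_preimage_emb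
      (measurableEmbedding_addLeft x), preimage_const_add_Ici, sub_self]

theorem lintegral_orthant_comp_smul (F : (κ → ℝ) → ℝ≥0∞) {c : ℝ} (hc : 0 < c) :
    ENNReal.ofReal c ^ Fintype.card κ * ∫⁻ y, F (c • y) ∂orthant κ = ∫⁻ y, F y ∂orthant κ := by
  have hpre : (fun y : κ → ℝ => c • y) ⁻¹' Ici 0 = Ici 0 := by
    ext y
    simp [Pi.le_def, mul_nonneg_iff_of_pos_left hc]
  have hmap : (orthant κ).map (c • ·) =
      ENNReal.ofReal |(c ^ Fintype.card κ)⁻¹| • orthant κ := by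
    rw [orthant_eq_restrict, ← Measure.restrict_smul, ← Module.finrank_fintype_fun_eq_card ℝ,
      ← Measure.map_addHaar_smul _ hc.ne', Measure.restrict_map (measurable_const_smul c)
        measurableSet_Ici, hpre]
  rw [← (measurableEmbedding_const_smul₀ hc.ne').lintegral_map, hmap, lintegral_smul_measure,
    smul_eq_mul, ← mul_assoc, ← ENNReal.ofReal_pow hc.le, ← ENNReal.ofReal_mul (by positivity),
    abs_of_pos (by positivity), mul_inv_cancel₀ (by positivity), ENNReal.ofReal_one, one_mul]

/-- The joint upper tail `x ↦ Q(∏ᵢ (xᵢ, ∞))` of a law on `κ → ℝ`. -/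
noncomputable def survival (Q : Measure (κ → ℝ)) (x : κ → ℝ) : ℝ :=
  Q.real {y | ∀ i, x i < y i}

theorem withDensity_setOf_forall_lt (F : (κ → ℝ) → ℝ≥0∞) {x : κ → ℝ} (hx : 0 ≤ x) :
    (orthant κ).withDensity F {y | ∀ i, x i < y i} = ∫⁻ y, F (x + y) ∂orthant κ := by
  rw [withDensity_apply', setLIntegral_congr (orthant_setOf_lt_ae_eq_Ici x),
    setLIntegral_orthant_Ici F hx]

namespace LogConcaveAntitoneLaw

theorem ae_pos (hQ : LogConcaveAntitoneLaw Q) : ∀ᵐ x ∂Q, ∀ i, 0 < x i := by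
  obtain ⟨F, -, rfl⟩ := hQ
  exact (withDensity_absolutelyContinuous _ _).ae_le (ae_orthant_pos κ)

theorem measureReal_forall_mem_lt (hQ : LogConcaveAntitoneLaw Q) (I : Finset κ) (s : κ → ℝ) :
    Q.real {x | ∀ i ∈ I, s i < x i} = survival Q ((I : Set κ).indicator s) := by
  refine measureReal_congr ?_
  filter_upwards [hQ.ae_pos] with x hx
  refine propext ⟨fun h i => ?_, fun h i hi => ?_⟩
  · by_cases hi : i ∈ I
    · simpa [hi] using h i hi
    · simpa [hi] using hx i
  · simpa [hi] using h i

theorem measureReal_lt (hQ : LogConcaveAntitoneLaw Q) [DecidableEq κ] (e : κ) (r : ℝ) :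
    Q.real {x | r < x e} = survival Q (Pi.single e r) := by
  have hind : (({e} : Finset κ) : Set κ).indicator (fun _ => r) = Pi.single e r := by
    ext i
    by_cases hi : i = e <;> simp [hi]
  simpa [hind] using hQ.measureReal_forall_mem_lt {e} fun _ => r

theorem survival_zero (hQ : LogConcaveAntitoneLaw Q) [IsProbabilityMeasure Q] :
    survival Q 0 = 1 := by
  simpa using (hQ.measureReal_forall_mem_lt ∅ 0).symm

theorem measure_rpow_mul_measure_rpow_le (hQ : LogConcaveAntitoneLaw Q) {a b : ℝ} (ha : 0 < a)
    (hb : 0 < b) (hab : a + b = 1) :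
    PrekopaLeindlerBound a b (fun x : κ → ℝ => Q {y | ∀ i, x i < y i})
      (fun x => Q {y | ∀ i, x i < y i}) fun x => Q {y | ∀ i, x i < y i} := by
  obtain ⟨F, hF, rfl⟩ := hQ
  intro x x' hx hx'
  have hc : 0 ≤ a • x + b • x' := add_nonneg (smul_nonneg ha.le hx) (smul_nonneg hb.le hx')
  simp only [withDensity_setOf_forall_lt F hx, withDensity_setOf_forall_lt F hx',
    withDensity_setOf_forall_lt F hc]
  have hmeas (x : κ → ℝ) : Measurable fun y => F (x + y) :=
    hF.measurable.comp (measurable_const_add x)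
  have hanti (x : κ → ℝ) : Antitone fun y => F (x + y) := fun y y' h =>
    hF.antitone (add_le_add_right h x)
  refine prekopaLeindler_orthant ha hb hab (hmeas _) (hmeas _) (hmeas _) (hanti _) (hanti _)
    (hanti _) fun y y' hy hy' => ?_
  rw [show a • x + b • x' + (a • y + b • y') = a • (x + y) + b • (x' + y') by module]
  exact hF.logConcave ha hb hab (add_nonneg hx hy) (add_nonneg hx' hy')

variable [IsProbabilityMeasure Q] {x y : κ → ℝ}

theorem survival_rpow_mul_survival_rpow_le (hQ : LogConcaveAntitoneLaw Q) {a b : ℝ} (ha : 0 < a)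
    (hb : 0 < b) (hab : a + b = 1) (hx : 0 ≤ x) (hy : 0 ≤ y) :
    survival Q x ^ a * survival Q y ^ b ≤ survival Q (a • x + b • y) := by
  simpa only [survival, Measure.real, ENNReal.toReal_mul, ENNReal.toReal_rpow] using
    ENNReal.toReal_mono (measure_ne_top _ _) (hQ.measure_rpow_mul_measure_rpow_le ha hb hab hx hy)

theorem survival_rpow_le (hQ : LogConcaveAntitoneLaw Q) {t : ℝ} (ht0 : 0 < t) (ht1 : t < 1)
    (hx : 0 ≤ x) : survival Q x ^ t ≤ survival Q (t • x) := by
  simpa [hQ.survival_zero] using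
    hQ.survival_rpow_mul_survival_rpow_le ht0 (sub_pos.2 ht1) (by ring) hx le_rfl

theorem survival_mul_rpow_le (hQ : LogConcaveAntitoneLaw Q) {r : ℝ} (hr0 : 0 < r) (hr1 : r < 1)
    (hx : 0 ≤ x) (hy : 0 ≤ y) :
    survival Q x * (survival Q ((2 : ℝ) • x) * survival Q ((2 / r) • y)) ^ r ≤
      survival Q (x + y) := by
  have hpow {z : κ → ℝ} {a : ℝ} (ha : a ≤ 1) : survival Q z ≤ survival Q z ^ a :=
    Real.self_le_rpow_of_le_one measureReal_nonneg measureReal_le_one ha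
  have h2x : 0 ≤ (2 : ℝ) • x := smul_nonneg zero_le_two hx
  have h2y : 0 ≤ (2 / r) • y := smul_nonneg (by positivity) hy
  set z := (1 / 2 : ℝ) • (2 : ℝ) • x + (1 / 2 : ℝ) • (2 / r) • y with hz
  have hz0 : 0 ≤ z := add_nonneg (smul_nonneg (by norm_num) h2x) (smul_nonneg (by norm_num) h2y)
  have hprod : survival Q ((2 : ℝ) • x) * survival Q ((2 / r) • y) ≤ survival Q z :=
    (mul_le_mul (hpow (by norm_num)) (hpow (by norm_num)) measureReal_nonneg
      (Real.rpow_nonneg measureReal_nonneg _)).trans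
      (hQ.survival_rpow_mul_survival_rpow_le one_half_pos one_half_pos (add_halves 1) h2x h2y)
  calc survival Q x * (survival Q ((2 : ℝ) • x) * survival Q ((2 / r) • y)) ^ r
      ≤ survival Q x ^ (1 - r) * survival Q z ^ r := by
        refine mul_le_mul (hpow (by linarith)) ?_ ?_ ?_
        · exact Real.rpow_le_rpow (mul_nonneg measureReal_nonneg measureReal_nonneg) hprod hr0.le
        · exact Real.rpow_nonneg (mul_nonneg measureReal_nonneg measureReal_nonneg) _
        · exact Real.rpow_nonneg measureReal_nonneg _
    _ ≤ survival Q ((1 - r) • x + r • z) :=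
        hQ.survival_rpow_mul_survival_rpow_le (sub_pos.2 hr1) hr0 (by ring) hx hz0
    _ = survival Q (x + y) := by
        congr 1
        ext i
        simp only [hz, Pi.add_apply, Pi.smul_apply, smul_eq_mul]
        field_simp
        ring

end LogConcaveAntitoneLaw

namespace LogConcaveAntitone

variable {F : (κ → ℝ) → ℝ≥0∞} {ε : ℝ≥0∞}

theorem withDensity_setOf_lt_le (hF : LogConcaveAntitone F) (ε : ℝ≥0∞) :
    (orthant κ).withDensity F {x | F x < ε ^ 2 * F 0} ≤
      ε * 2 ^ Fintype.card κ * ∫⁻ x, F x ∂orthant κ := by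
  have hscale : 2 ^ Fintype.card κ * ∫⁻ x, F x ∂orthant κ =
      ∫⁻ x, F ((1 / 2 : ℝ) • x) ∂orthant κ := by
    simpa [smul_smul] using lintegral_orthant_comp_smul (fun x => F ((1 / 2 : ℝ) • x)) two_pos
  have hmeas : MeasurableSet {x | F x < ε ^ 2 * F 0} :=
    measurableSet_lt hF.measurable measurable_const
  calc (orthant κ).withDensity F {x | F x < ε ^ 2 * F 0}
      = ∫⁻ x in {x | F x < ε ^ 2 * F 0}, F x ∂orthant κ := withDensity_apply _ hmeas
    _ ≤ ∫⁻ x in {x | F x < ε ^ 2 * F 0}, ε * F ((1 / 2 : ℝ) • x) ∂orthant κ :=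
        setLIntegral_mono_ae' hmeas <| (ae_orthant_nonneg κ).mono fun x hx hlt =>
          hF.le_apply_half_smul hx (le_of_lt hlt)
    _ ≤ ∫⁻ x, ε * F ((1 / 2 : ℝ) • x) ∂orthant κ := setLIntegral_le_lintegral _ _
    _ = ε * 2 ^ Fintype.card κ * ∫⁻ x, F x ∂orthant κ := by
        rw [mul_assoc, hscale]
        exact lintegral_const_mul _ (hF.measurable.comp (measurable_const_smul _))

theorem le_withDensity_setOf_forall_lt (hF : LogConcaveAntitone F) {θ : κ → ℝ} (hθ : 0 ≤ θ)
    (hε : ε ^ 2 * F 0 ≤ F θ) :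
    ε * 2⁻¹ ^ Fintype.card κ * ∫⁻ x, F x ∂orthant κ ≤
      (orthant κ).withDensity F {y | ∀ i, ((1 / 2 : ℝ) • θ) i < y i} := by
  have hhalf : ENNReal.ofReal (1 / 2) = 2⁻¹ := by
    rw [one_div, ENNReal.ofReal_inv_of_pos two_pos, ENNReal.ofReal_ofNat]
  rw [withDensity_setOf_forall_lt F (smul_nonneg one_half_pos.le hθ),
    ← lintegral_orthant_comp_smul (fun y => F ((1 / 2 : ℝ) • θ + y)) one_half_pos, hhalf,
    mul_comm ε, mul_assoc, ← lintegral_const_mul _ hF.measurable]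
  gcongr 2⁻¹ ^ _ * ?_
  exact lintegral_mono_ae <| (ae_orthant_nonneg κ).mono fun y hy =>
    hF.mul_apply_le_apply_half_smul_add hθ hy hε

end LogConcaveAntitone

theorem div_eight_lt_setAverage_min {α : Type*} [MeasurableSpace α] {μ : Measure α}
    [IsProbabilityMeasure μ] {K : Set α} (hK : MeasurableSet K) (hμK : 3 / 4 ≤ μ.real K)
    {g : α → ℝ} (hg : Measurable g) (hgK : ∀ x ∈ K, 0 ≤ g x) {c : ℝ} (hc : 0 < c)
    (hhalf : 1 / 2 ≤ μ.real {x | c < g x}) : c / 8 < ⨍ x in K, min (g x) c ∂μ := by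
  have hmin : ∀ᵐ x ∂μ.restrict K, 0 ≤ min (g x) c := by
    filter_upwards [ae_restrict_mem hK] with x hx using le_min (hgK x hx) hc.le
  have hint : IntegrableOn (fun x => min (g x) c) K μ := by
    refine Measure.integrableOn_of_bounded (M := c) (measure_ne_top _ _)
      (hg.min measurable_const).aestronglyMeasurable (hmin.mono fun x hx => ?_)
    rw [Real.norm_of_nonneg hx]
    exact min_le_right _ _
  have hquarter : 1 / 4 ≤ (μ.restrict K).real {x | c ≤ min (g x) c} := by
    rw [measureReal_restrict_apply' hK]
    have hsub : {x | c < g x} ∩ K ⊆ {x | c ≤ min (g x) c} ∩ K :=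
      inter_subset_inter_left _ fun x (hx : c < g x) => le_min hx.le le_rfl
    linarith [measureReal_union_add_inter (s := {x | c < g x}) hK (μ := μ),
      measureReal_le_one (μ := μ) (s := {x | c < g x} ∪ K), measureReal_mono hsub (μ := μ)]
  have hmarkov := mul_meas_ge_le_integral_of_nonneg hmin hint c
  have hone : 1 ≤ (μ.real K)⁻¹ := (one_le_inv₀ (by linarith)).2 measureReal_le_one
  calc c / 8 < ∫ x in K, min (g x) c ∂μ := by nlinarith
    _ ≤ (μ.real K)⁻¹ * ∫ x in K, min (g x) c ∂μ :=
        le_mul_of_one_le_left (integral_nonneg_of_ae hmin) hone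
    _ = ⨍ x in K, min (g x) c ∂μ := by rw [setAverage_eq, smul_eq_mul]

theorem smul_mem_of_convex_of_half_le {ι : Type*} [Finite ι] {Q : Measure (ι → ℝ)}
    [IsProbabilityMeasure Q] {K : Set (ι → ℝ)} (hK : MeasurableSet K) (hconv : Convex ℝ K)
    (hpos : K ⊆ Ici 0) (hlower : ∀ ⦃x y⦄, x ∈ K → 0 ≤ y → y ≤ x → y ∈ K) (hQK : 3 / 4 ≤ Q.real K)
    {s : ι → ℝ} (hs : ∀ i, 0 < s i) (hhalf : ∀ i, 1 / 2 ≤ Q.real {x | s i < x i}) :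
    (1 / 8 : ℝ) • s ∈ K := by
  have := Fintype.ofFinite ι
  have hs0 : 0 ≤ s := fun i => (hs i).le
  have hmem {x} (hx : x ∈ K) : x ⊓ s ∈ K := hlower hx (le_inf (hpos hx) hs0) inf_le_left
  have hint : IntegrableOn (fun x : ι → ℝ => x ⊓ s) K Q := by
    refine Measure.integrableOn_of_bounded (M := ‖s‖) (measure_ne_top _ _)
      (Measurable.aestronglyMeasurable <|
        measurable_pi_lambda _ fun i => (measurable_pi_apply i).min measurable_const) ?_
    filter_upwards [ae_restrict_mem hK] with x hx
    refine (pi_norm_le_iff_of_nonneg (norm_nonneg _)).2 fun i => ?_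
    rw [Real.norm_of_nonneg (hpos (hmem hx) i)]
    exact (inf_le_right : x i ⊓ s i ≤ s i).trans ((le_abs_self _).trans (norm_le_pi_norm s i))
  have havg : (⨍ x in K, x ⊓ s ∂Q) ∈ closure K :=
    hconv.set_average_mem_closure (fun h => by norm_num [Measure.real, h] at hQK)
      (measure_ne_top _ _) ((ae_restrict_mem hK).mono fun x hx => hmem hx) hint
  have hlow (i : ι) : ((1 / 8 : ℝ) • s) i < (⨍ x in K, x ⊓ s ∂Q) i := by
    have h := div_eight_lt_setAverage_min hK hQK (measurable_pi_apply i)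
      (fun x hx => hpos hx i) (hs i) (hhalf i)
    rw [Pi.smul_apply, smul_eq_mul, one_div_mul_eq_div, setAverage_eq, Pi.smul_apply,
      eval_integral fun i => hint.eval i]
    rwa [setAverage_eq] at h
  obtain ⟨x, hx, hxK⟩ := mem_closure_iff.1 havg _ (isOpen_setOf_forall_gt _) hlow
  exact hlower hxK (smul_nonneg (by norm_num) hs0) fun i => (hx i).le

namespace LogConcaveAntitoneLaw

theorem inv_four_pow_le_survival [IsProbabilityMeasure Q] (hQ : LogConcaveAntitoneLaw Q)
    {s : κ → ℝ} (hs : ∀ i, 0 < s i) (hhalf : ∀ i, 1 / 2 ≤ Q.real {x | s i < x i}) :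
    4⁻¹ ^ (Fintype.card κ + 1) ≤ survival Q ((1 / 16 : ℝ) • s) := by
  have hpos := hQ.ae_pos
  obtain ⟨F, hF, hQF⟩ := hQ
  have hF1 : ∫⁻ x, F x ∂orthant κ = 1 := by
    rw [← setLIntegral_univ, ← withDensity_apply _ MeasurableSet.univ, ← hQF, measure_univ]
  set m := Fintype.card κ
  set ε : ℝ≥0∞ := 4⁻¹ * 2⁻¹ ^ m with hε
  set K : Set (κ → ℝ) := {x | 0 ≤ x ∧ ε ^ 2 * F 0 ≤ F x}
  have hK : MeasurableSet K :=
    measurableSet_Ici.inter (measurableSet_le measurable_const hF.measurable)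
  have hQKc : Q Kᶜ ≤ 4⁻¹ :=
    calc Q Kᶜ ≤ Q {x | F x < ε ^ 2 * F 0} := measure_mono_ae <| by
          filter_upwards [hpos] with x hx hxK
          exact not_le.1 fun h => hxK ⟨fun i => (hx i).le, h⟩
      _ ≤ ε * 2 ^ m := by simpa [hQF, hF1] using hF.withDensity_setOf_lt_le ε
      _ = 4⁻¹ := by
          rw [hε, mul_assoc, ← mul_pow, ENNReal.inv_mul_cancel two_ne_zero ENNReal.ofNat_ne_top,
            one_pow, mul_one]
  have hQK : 3 / 4 ≤ Q.real K := by
    have hle : Q.real Kᶜ ≤ 4⁻¹ := by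
      simpa [Measure.real] using ENNReal.toReal_mono (by simp) hQKc
    linarith [probReal_add_probReal_compl hK (μ := Q)]
  have hs8 : (1 / 8 : ℝ) • s ∈ K := smul_mem_of_convex_of_half_le hK (hF.convex_setOf_le _)
    (fun x hx => hx.1) (fun x y hx hy hyx => ⟨hy, hx.2.trans (hF.antitone hyx)⟩) hQK hs hhalf
  have hlow := hF.le_withDensity_setOf_forall_lt hs8.1 hs8.2
  rw [hF1, mul_one, ← hQF, hε, mul_assoc, ← mul_pow, smul_smul] at hlow
  have hreal := ENNReal.toReal_mono (measure_ne_top _ _) hlow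
  norm_num at hreal
  simpa only [survival, pow_succ', one_div, Measure.real, inv_pow, Pi.smul_apply, smul_eq_mul]
    using hreal

theorem exp_le_survival [IsProbabilityMeasure Q] (hQ : LogConcaveAntitoneLaw Q)
    {s : κ → ℝ} (hs : ∀ i, 0 < s i) (hhalf : ∀ i, 1 / 2 ≤ Q.real {x | s i < x i}) {t : ℝ}
    (ht0 : 0 < t) (ht1 : t < 1) :
    Real.exp (-(2 * t * (Fintype.card κ + 1))) ≤ survival Q ((t / 16) • s) := by
  have hexp : Real.exp (-2) ≤ 4⁻¹ := by
    rw [show (-2 : ℝ) = -1 + -1 by norm_num, Real.exp_add]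
    nlinarith [Real.exp_neg_one_lt_half, Real.exp_pos (-1)]
  calc Real.exp (-(2 * t * (Fintype.card κ + 1)))
      = (Real.exp (-2) ^ (Fintype.card κ + 1)) ^ t := by
        rw [← Real.exp_nat_mul, ← Real.exp_mul]
        congr 1
        push_cast
        ring
    _ ≤ (4⁻¹ ^ (Fintype.card κ + 1)) ^ t := by gcongr
    _ ≤ survival Q ((1 / 16 : ℝ) • s) ^ t := by
        gcongr
        exact hQ.inv_four_pow_le_survival hs hhalf
    _ ≤ survival Q (t • (1 / 16 : ℝ) • s) :=
        hQ.survival_rpow_le ht0 ht1 (smul_nonneg (by norm_num) fun i => (hs i).le)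
    _ = survival Q ((t / 16) • s) := by rw [smul_smul, mul_one_div]

theorem exp_le_measureReal_forall_mem_lt [IsProbabilityMeasure Q] (hQ : LogConcaveAntitoneLaw Q)
    {I : Finset κ} {s : ℝ} (hs : 0 < s) (hhalf : ∀ e ∈ I, 1 / 2 ≤ Q.real {x | s < x e}) {t : ℝ}
    (ht0 : 0 < t) (ht1 : t < 1) :
    Real.exp (-(2 * t * (I.card + 1))) ≤ Q.real {x | ∀ e ∈ I, t * s / 16 < x e} := by
  classical
  have hπ : Measurable fun (x : κ → ℝ) (i : {i // i ∈ I}) => x i := by fun_prop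
  have : IsProbabilityMeasure (Q.map fun x (i : {i // i ∈ I}) => x i) :=
    Measure.isProbabilityMeasure_map hπ.aemeasurable
  have hmap (r : {i // i ∈ I} → ℝ) := map_measureReal_apply (μ := Q) hπ
    (isOpen_setOf_forall_gt r).measurableSet
  have h := (hQ.map_subtype (· ∈ I)).exp_le_survival (s := fun _ => s) (fun _ => hs)
    (fun i => ?_) ht0 ht1
  · rw [Fintype.card_coe, survival, hmap] at h
    convert h using 2
    ext x
    simp [div_mul_eq_mul_div]
  · rw [map_measureReal_apply hπ (measurableSet_lt measurable_const (measurable_pi_apply i))]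
    exact hhalf i i.2

end LogConcaveAntitoneLaw

namespace LogConcaveAntitoneLaw

variable [IsProbabilityMeasure Q]

theorem measureReal_erase_mul_rpow_le [DecidableEq κ] (hQ : LogConcaveAntitoneLaw Q)
    {I : Finset κ} {e : κ} (he : e ∈ I) {p r : ℝ} (hp : 0 ≤ p) (hr0 : 0 < r) (hr1 : r < 1) :
    Q.real {x | ∀ i ∈ I.erase e, p < x i} *
        (Q.real {x | ∀ i ∈ I.erase e, 2 * p < x i} * Q.real {x | 2 / r * p < x e}) ^ r ≤
      Q.real {x | ∀ i ∈ I, p < x i} := by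
  have h2x : ((I.erase e : Set κ).indicator fun _ => 2 * p) =
      (2 : ℝ) • (I.erase e : Set κ).indicator fun _ => p :=
    indicator_const_smul _ (2 : ℝ) fun _ => p
  have hxy : ((I : Set κ).indicator fun _ => p) =
      ((I.erase e : Set κ).indicator fun _ => p) + Pi.single e p := by
    ext i
    by_cases hi : i = e
    · simp [hi, he]
    · simp [hi, indicator_apply]
  simp only [hQ.measureReal_forall_mem_lt, hQ.measureReal_lt]
  rw [h2x, hxy, ← smul_eq_mul (2 / r), Pi.single_smul]
  exact hQ.survival_mul_rpow_le hr0 hr1 (indicator_nonneg fun _ _ => hp) (Pi.single_nonneg.2 hp)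

theorem one_sub_mul_measureReal_erase_le [DecidableEq κ] (hQ : LogConcaveAntitoneLaw Q)
    {I : Finset κ} {e : κ} (he : e ∈ I) {s : ℝ} (hs : 0 < s)
    (hhalf : ∀ e ∈ I, 1 / 2 ≤ Q.real {x | s < x e}) {t : ℝ} (ht0 : 0 < t) (ht : t < 1 / 2) :
    (1 - t / 8 * (4 * t * I.card + 1)) * Q.real {x | ∀ i ∈ I.erase e, t * s / 16 < x i} ≤
      Q.real {x | ∀ i ∈ I, t * s / 16 < x i} := by
  set p := t * s / 16 with hp
  have hdouble : Real.exp (-(4 * t * I.card)) ≤ Q.real {x | ∀ i ∈ I.erase e, 2 * p < x i} := by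
    rw [show 2 * p = 2 * t * s / 16 by rw [hp]; ring]
    convert hQ.exp_le_measureReal_forall_mem_lt hs
      (fun i hi => hhalf i (Finset.mem_of_mem_erase hi)) (t := 2 * t) (by linarith)
      (by linarith) using 3
    rw [← Finset.card_erase_add_one he]
    push_cast
    ring
  have hsingle : Real.exp (-1) ≤ Q.real {x | 2 / (t / 8) * p < x e} := by
    rw [show 2 / (t / 8) * p = s by rw [hp]; field_simp; norm_num]
    exact Real.exp_neg_one_lt_half.le.trans (hhalf e he)
  calc (1 - t / 8 * (4 * t * I.card + 1)) * Q.real {x | ∀ i ∈ I.erase e, p < x i}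
      ≤ Real.exp (-(t / 8 * (4 * t * I.card + 1))) * Q.real {x | ∀ i ∈ I.erase e, p < x i} :=
        mul_le_mul_of_nonneg_right (Real.one_sub_le_exp_neg _) measureReal_nonneg
    _ = Q.real {x | ∀ i ∈ I.erase e, p < x i} *
          (Real.exp (-(4 * t * I.card)) * Real.exp (-1)) ^ (t / 8) := by
        rw [← Real.exp_add, ← Real.exp_mul, mul_comm]
        ring_nf
    _ ≤ Q.real {x | ∀ i ∈ I.erase e, p < x i} * (Q.real {x | ∀ i ∈ I.erase e, 2 * p < x i} *
          Q.real {x | 2 / (t / 8) * p < x e}) ^ (t / 8) := by gcongr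
    _ ≤ Q.real {x | ∀ i ∈ I, p < x i} :=
        hQ.measureReal_erase_mul_rpow_le he (by positivity) (by positivity) (by linarith)

theorem measureReal_lt_rpow_le (hQ : LogConcaveAntitoneLaw Q) (e : κ) {r t : ℝ} (hr : 0 ≤ r)
    (ht0 : 0 < t) (ht1 : t < 1) : Q.real {x | r < x e} ^ t ≤ Q.real {x | t * r < x e} := by
  classical
  rw [hQ.measureReal_lt, hQ.measureReal_lt, ← smul_eq_mul, Pi.single_smul]
  exact hQ.survival_rpow_le ht0 ht1 (Pi.single_nonneg.2 hr)

end LogConcaveAntitoneLaw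

theorem lintegral_Ioi_mul_exp_neg {b : ℝ} (hb : 0 < b) :
    ∫⁻ t in Ioi 0, ENNReal.ofReal (t * Real.exp (-(b * t))) = ENNReal.ofReal (1 / b ^ 2) := by
  have h : ∫ t in Ioi (0 : ℝ), t * Real.exp (-(b * t)) = 1 / b ^ 2 := by
    have hgamma := Real.integral_rpow_mul_exp_neg_mul_Ioi two_pos hb
    norm_num at hgamma
    simpa using hgamma
  rw [← h]
  refine (ofReal_integral_eq_lintegral_ofReal ?_ ?_).symm
  · exact Integrable.of_integral_ne_zero (by rw [h]; positivity)
  · filter_upwards [ae_restrict_mem measurableSet_Ioi] with t ht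
    exact mul_nonneg (le_of_lt ht) (Real.exp_nonneg _)

theorem integrable_sq_of_measureReal_lt_le_exp {α : Type*} [MeasurableSpace α] {μ : Measure α}
    [IsFiniteMeasure μ] {g : α → ℝ} (hg : AEMeasurable g μ) (hg0 : 0 ≤ᵐ[μ] g) {b C : ℝ}
    (hb : 0 < b) (hC : 0 ≤ C)
    (htail : ∀ t, 0 < t → μ.real {x | t < g x} ≤ C * Real.exp (-(b * t))) :
    Integrable (fun x => g x ^ 2) μ ∧ ∫ x, g x ^ 2 ∂μ ≤ 2 * C / b ^ 2 := by
  have hle : ∫⁻ x, ENNReal.ofReal (g x ^ 2) ∂μ ≤ ENNReal.ofReal (2 * C / b ^ 2) :=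
    calc ∫⁻ x, ENNReal.ofReal (g x ^ 2) ∂μ
        = ENNReal.ofReal 2 * ∫⁻ t in Ioi 0, μ {x | t < g x} * ENNReal.ofReal t := by
          simpa [show (2 : ℝ) - 1 = 1 by norm_num] using
            lintegral_rpow_eq_lintegral_meas_lt_mul μ hg0 hg two_pos
      _ ≤ ENNReal.ofReal 2 *
            ∫⁻ t in Ioi 0, ENNReal.ofReal C * ENNReal.ofReal (t * Real.exp (-(b * t))) := by
          gcongr ENNReal.ofReal 2 * ?_
          refine setLIntegral_mono' measurableSet_Ioi fun t ht => ?_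
          rw [← ofReal_measureReal, ← ENNReal.ofReal_mul measureReal_nonneg,
            ← ENNReal.ofReal_mul hC, mul_left_comm, mul_comm t]
          exact ENNReal.ofReal_le_ofReal (mul_le_mul_of_nonneg_right (htail t ht) (le_of_lt ht))
      _ = ENNReal.ofReal (2 * C / b ^ 2) := by
          rw [lintegral_const_mul' _ _ ENNReal.ofReal_ne_top, lintegral_Ioi_mul_exp_neg hb,
            ← ENNReal.ofReal_mul hC, ← ENNReal.ofReal_mul zero_le_two, mul_one_div, mul_div_assoc]
  have hnonneg : 0 ≤ᵐ[μ] fun x => g x ^ 2 := .of_forall fun x => sq_nonneg _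
  have hmeas : AEStronglyMeasurable (fun x => g x ^ 2) μ := (hg.pow_const 2).aestronglyMeasurable
  refine ⟨⟨hmeas, (hasFiniteIntegral_iff_ofReal hnonneg).2
    (hle.trans_lt ENNReal.ofReal_lt_top)⟩, ?_⟩
  rw [integral_eq_lintegral_of_nonneg_ae hnonneg hmeas]
  exact ENNReal.toReal_le_of_le_ofReal (by positivity) hle

namespace LogConcaveAntitoneLaw

variable [IsProbabilityMeasure Q]

theorem measureReal_lt_le_exp_mul_div (hQ : LogConcaveAntitoneLaw Q) {e : κ} {r t c : ℝ}
    (hr : 0 < r) (hrt : r < t) (hc : Q.real {x | r < x e} ≤ Real.exp (-c)) :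
    Q.real {x | t < x e} ≤ Real.exp (-(c * (t / r))) := by
  have ht : 0 < t := hr.trans hrt
  have hroot : Q.real {x | t < x e} ^ (r / t) ≤ Real.exp (-c) := by
    have h := hQ.measureReal_lt_rpow_le e ht.le (div_pos hr ht) ((div_lt_one ht).2 hrt)
    rw [div_mul_cancel₀ r ht.ne'] at h
    exact h.trans hc
  calc Q.real {x | t < x e} = (Q.real {x | t < x e} ^ (r / t)) ^ (t / r) := by
        rw [← Real.rpow_mul measureReal_nonneg, div_mul_div_cancel₀ ht.ne', div_self hr.ne',
          Real.rpow_one]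
    _ ≤ Real.exp (-c) ^ (t / r) := by gcongr
    _ = Real.exp (-(c * (t / r))) := by rw [← Real.exp_mul, neg_mul]

theorem measureReal_lt_le_exp_of_le_half (hQ : LogConcaveAntitoneLaw Q) {e : κ} {r : ℝ} (hr : 0 < r)
    (hhalf : Q.real {x | r < x e} ≤ 1 / 2) {t : ℝ} (ht : 0 < t) :
    Q.real {x | t < x e} ≤ 2 * Real.exp (-(2 / (3 * r) * t)) := by
  have hexp : 1 / 2 ≤ Real.exp (-(2 / 3)) := by
    rw [← Real.log_le_iff_le_exp one_half_pos, one_div, Real.log_inv]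
    linarith [Real.log_two_gt_d9]
  rcases le_or_gt t r with htr | htr
  · have hmono : Real.exp (-(2 / 3)) ≤ Real.exp (-(2 / (3 * r) * t)) := by
      gcongr
      rw [div_mul_eq_mul_div, div_le_div_iff₀ (by positivity) (by norm_num)]
      linarith
    linarith [measureReal_le_one (μ := Q) (s := {x | t < x e})]
  · calc Q.real {x | t < x e}
        ≤ Real.exp (-(2 / 3 * (t / r))) :=
          hQ.measureReal_lt_le_exp_mul_div hr htr (hhalf.trans hexp)
      _ = Real.exp (-(2 / (3 * r) * t)) := by
          congr 1
          field_simp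
      _ ≤ 2 * Real.exp (-(2 / (3 * r) * t)) :=
          le_mul_of_one_le_left (Real.exp_nonneg _) one_le_two

theorem integrable_sq_of_le_half (hQ : LogConcaveAntitoneLaw Q) {e : κ} {r : ℝ} (hr : 0 < r)
    (hhalf : Q.real {x | r < x e} ≤ 1 / 2) :
    Integrable (fun x => x e ^ 2) Q ∧ ∫ x, x e ^ 2 ∂Q ≤ 9 * r ^ 2 := by
  have h := integrable_sq_of_measureReal_lt_le_exp (measurable_pi_apply e).aemeasurable
    (hQ.ae_pos.mono fun x hx => (hx e).le) (b := 2 / (3 * r)) (by positivity) zero_le_two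
    fun t ht => hQ.measureReal_lt_le_exp_of_le_half hr hhalf ht
  rwa [show 2 * 2 / (2 / (3 * r)) ^ 2 = 9 * r ^ 2 by field_simp; norm_num] at h

theorem integrable_sq (hQ : LogConcaveAntitoneLaw Q) (e : κ) :
    Integrable (fun x => x e ^ 2) Q := by
  have heval := measurable_pi_apply (X := fun _ : κ => ℝ) e
  have : IsProbabilityMeasure (Q.map (· e)) := Measure.isProbabilityMeasure_map heval.aemeasurable
  obtain ⟨r, hr, hr0⟩ := (((ProbabilityTheory.tendsto_cdf_atTop (Q.map (· e))).eventually
    (lt_mem_nhds one_half_lt_one)).and (Filter.eventually_gt_atTop 0)).exists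
  rw [ProbabilityTheory.cdf_eq_real, map_measureReal_apply heval measurableSet_Iic] at hr
  refine (hQ.integrable_sq_of_le_half (e := e) hr0 ?_).1
  linarith [measureReal_le_eq_one_sub (Q := Q) e r, show 1 / 2 < Q.real {x | x e ≤ r} from hr]

theorem integral_sq_pos (hQ : LogConcaveAntitoneLaw Q) (e : κ) : 0 < ∫ x, x e ^ 2 ∂Q := by
  refine (integral_pos_iff_support_of_nonneg (fun x => sq_nonneg _) (hQ.integrable_sq e)).2 ?_
  have hsupp : Function.support (fun x : κ → ℝ => x e ^ 2) =ᵐ[Q] univ :=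
    Filter.eventuallyEq_univ.2 (hQ.ae_pos.mono fun x hx => pow_ne_zero 2 (hx e).ne')
  rw [measure_congr hsupp, measure_univ]
  exact one_pos

theorem half_le_measureReal_lt (hQ : LogConcaveAntitoneLaw Q) {e : κ} {σ : ℝ} (hσ : 0 < σ)
    (hσe : σ ^ 2 ≤ ∫ x, x e ^ 2 ∂Q) : 1 / 2 ≤ Q.real {x | σ / 4 < x e} := by
  by_contra! h
  nlinarith [(hQ.integrable_sq_of_le_half (div_pos hσ four_pos) h.le).2]

theorem measureReal_lt_le_quarter (hQ : LogConcaveAntitoneLaw Q) {e : κ} {σ : ℝ} (hσ : 0 < σ)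
    (hσe : ∫ x, x e ^ 2 ∂Q ≤ σ ^ 2) : Q.real {x | 2 * σ < x e} ≤ 1 / 4 := by
  have hmarkov := mul_meas_ge_le_integral_of_nonneg (f := fun x : κ → ℝ => x e ^ 2)
    (Filter.Eventually.of_forall fun x => sq_nonneg (x e)) (hQ.integrable_sq e)
    ((2 * σ) ^ 2)
  have hsub : {x : κ → ℝ | 2 * σ < x e} ⊆ {x | (2 * σ) ^ 2 ≤ x e ^ 2} := fun x hx =>
    pow_le_pow_left₀ (a := 2 * σ) (by positivity) (le_of_lt hx) 2
  have hmono := measureReal_mono (μ := Q) hsub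
  have hσ2 : 0 < σ ^ 2 := by positivity
  nlinarith

end LogConcaveAntitoneLaw

theorem LogConcaveAntitoneLaw.ofReal_pow_mul_measure_preimage_smul_le
    (hQ : LogConcaveAntitoneLaw Q) {t : ℝ} (ht0 : 0 < t) (ht1 : t ≤ 1) {B : Set (κ → ℝ)}
    (hB : MeasurableSet B) :
    ENNReal.ofReal t ^ Fintype.card κ * Q ((t • ·) ⁻¹' B) ≤ Q B := by
  obtain ⟨F, hF, rfl⟩ := hQ
  rw [withDensity_apply _ hB, withDensity_apply _ (measurable_const_smul t hB),
    ← lintegral_indicator hB, ← lintegral_indicator (measurable_const_smul t hB),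
    ← lintegral_orthant_comp_smul (B.indicator F) ht0]
  gcongr ENNReal.ofReal t ^ _ * ?_
  refine lintegral_mono_ae ((ae_orthant_nonneg κ).mono fun x hx => ?_)
  rw [← indicator_comp_right]
  exact indicator_le_indicator (hF.antitone fun i => mul_le_of_le_one_left (hx i) ht1)

namespace LogConcaveAntitoneLaw

variable [IsProbabilityMeasure Q]

theorem mul_measureReal_le_le (hQ : LogConcaveAntitoneLaw Q) (e : κ) {t : ℝ} (ht0 : 0 < t)
    (ht1 : t ≤ 1) (r : ℝ) : t * Q.real {x | x e ≤ r} ≤ Q.real {x | x e ≤ t * r} := by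
  classical
  have hπ : Measurable fun (x : κ → ℝ) (i : {i // i = e}) => x i := by fun_prop
  have hmeas (s : ℝ) : MeasurableSet {y : {i // i = e} → ℝ | y ⟨e, rfl⟩ ≤ s} :=
    measurableSet_le (measurable_pi_apply _) measurable_const
  have h := (hQ.map_subtype (· = e)).ofReal_pow_mul_measure_preimage_smul_le ht0 ht1
    (hmeas (t * r))
  have hpre : (t • ·) ⁻¹' {y : {i // i = e} → ℝ | y ⟨e, rfl⟩ ≤ t * r} = {y | y ⟨e, rfl⟩ ≤ r} := by
    ext y
    exact mul_le_mul_iff_right₀ ht0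
  rw [hpre, Measure.map_apply hπ (hmeas _), Measure.map_apply hπ (hmeas _), Fintype.card_unique,
    pow_one] at h
  simpa [Measure.real, ht0.le] using ENNReal.toReal_mono (measure_ne_top _ _) h

theorem measureReal_lt_le_exp (hQ : LogConcaveAntitoneLaw Q) {e : κ} {σ : ℝ} (hσ : 0 < σ)
    (hσe : ∫ x, x e ^ 2 ∂Q ≤ σ ^ 2) {s : ℝ} (hs : 0 < s) :
    Q.real {x | s < x e} ≤ Real.exp (-(s / (4 * σ))) := by
  have hquarter := hQ.measureReal_lt_le_quarter hσ hσe
  rcases le_or_gt s (2 * σ) with hsσ | hsσ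
  · have hscale := hQ.mul_measureReal_le_le e (t := s / (2 * σ)) (by positivity)
      ((div_le_one (by positivity)).2 hsσ) (2 * σ)
    rw [div_mul_cancel₀ s (by positivity), measureReal_le_eq_one_sub,
      measureReal_le_eq_one_sub] at hscale
    have ht : s / (4 * σ) = s / (2 * σ) / 2 := by ring
    have ht0 : 0 < s / (2 * σ) := by positivity
    nlinarith [Real.one_sub_le_exp_neg (s / (4 * σ))]
  · have hexp : 1 / 4 ≤ Real.exp (-(1 / 2)) := by
      linarith [Real.one_sub_le_exp_neg (1 / 2 : ℝ)]
    convert hQ.measureReal_lt_le_exp_mul_div (by positivity) hsσ (hquarter.trans hexp) using 2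
    ring

end LogConcaveAntitoneLaw

end Law

section SecondMoment

variable {α V : Type*} [MeasurableSpace α] [Fintype V] {Q : Measure α} {A : V → Set α}

theorem integrable_sum_indicator_one [IsFiniteMeasure Q] (hA : ∀ v, MeasurableSet (A v)) :
    Integrable (fun x => ∑ v, (A v).indicator (1 : α → ℝ) x) Q :=
  integrable_finsetSum _ fun v _ => (integrable_const 1).indicator (hA v)

theorem integral_sum_indicator_one [IsFiniteMeasure Q] (hA : ∀ v, MeasurableSet (A v)) :
    ∫ x, ∑ v, (A v).indicator (1 : α → ℝ) x ∂Q = ∑ v, Q.real (A v) := by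
  rw [integral_finsetSum _ fun v _ => (integrable_const 1).indicator (hA v)]
  exact Finset.sum_congr rfl fun v _ => integral_indicator_one (hA v)

-- Chung–Erdős: `f` is supported in the union, so `c ↦ ∫ (c f - 𝟙_⋃) ^ 2` is a nonnegative
-- quadratic polynomial and its discriminant is not positive.
theorem sq_sum_measureReal_le_mul_measureReal_iUnion [IsFiniteMeasure Q]
    (hA : ∀ v, MeasurableSet (A v)) :
    (∑ v, Q.real (A v)) ^ 2 ≤ (∑ u, ∑ v, Q.real (A u ∩ A v)) * Q.real (⋃ v, A v) := by
  set f : α → ℝ := fun x => ∑ v, (A v).indicator 1 x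
  have hsq : (fun x => f x ^ 2) = fun x => ∑ w : V × V, (A w.1 ∩ A w.2).indicator 1 x :=
    funext fun x => by
      simp only [f, sq, Finset.sum_mul_sum, Fintype.sum_prod_type, inter_indicator_one,
        Pi.mul_apply]
  have hA2 (w : V × V) : MeasurableSet (A w.1 ∩ A w.2) := (hA w.1).inter (hA w.2)
  have hf : Integrable f Q := integrable_sum_indicator_one hA
  have hf2 : Integrable (fun x => f x ^ 2) Q := hsq ▸ integrable_sum_indicator_one hA2
  have hU : MeasurableSet (⋃ v, A v) := .iUnion hA
  have hexpand (c : ℝ) (x : α) : (c * f x - (⋃ v, A v).indicator 1 x) ^ 2 =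
      c ^ 2 * f x ^ 2 - 2 * c * f x + (⋃ v, A v).indicator 1 x := by
    by_cases hx : x ∈ ⋃ v, A v
    · simp only [indicator_of_mem hx, Pi.one_apply]
      ring
    · have hfx : f x = 0 := Finset.sum_eq_zero fun v _ =>
        indicator_of_notMem (fun h => hx (mem_iUnion_of_mem v h)) _
      simp [indicator_of_notMem hx, hfx]
  have hquad (c : ℝ) :
      0 ≤ (∫ x, f x ^ 2 ∂Q) * (c * c) + (-2 * ∫ x, f x ∂Q) * c + Q.real (⋃ v, A v) := by
    calc 0 ≤ ∫ x, (c * f x - (⋃ v, A v).indicator 1 x) ^ 2 ∂Q :=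
          integral_nonneg fun x => sq_nonneg _
      _ = ∫ x, (c ^ 2 * f x ^ 2 - 2 * c * f x + (⋃ v, A v).indicator 1 x) ∂Q :=
          integral_congr_ae (.of_forall (hexpand c))
      _ = c ^ 2 * (∫ x, f x ^ 2 ∂Q) - 2 * c * (∫ x, f x ∂Q) + Q.real (⋃ v, A v) := by
          rw [integral_add (f := fun x => c ^ 2 * f x ^ 2 - 2 * c * f x)
            ((hf2.const_mul _).sub (hf.const_mul _)) ((integrable_const 1).indicator hU),
            integral_sub (hf2.const_mul _) (hf.const_mul _), integral_const_mul,
            integral_const_mul, integral_indicator_one hU]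
      _ = _ := by ring
  have hdiscrim := discrim_le_zero hquad
  rw [discrim, hsq, integral_sum_indicator_one hA, integral_sum_indicator_one hA2,
    Fintype.sum_prod_type] at hdiscrim
  linarith

theorem sum_sum_measureReal_inter_le {η : ℝ} (hη : η < 1)
    (hpair : ∀ u v, u ≠ v → (1 - η) * Q.real (A u ∩ A v) ≤ Q.real (A u) * Q.real (A v)) :
    ∑ u, ∑ v, Q.real (A u ∩ A v) ≤
      ∑ v, Q.real (A v) + (∑ v, Q.real (A v)) ^ 2 / (1 - η) := by
  classical
  have hη' : 0 < 1 - η := sub_pos.2 hη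
  have hterm (u v : V) : Q.real (A u ∩ A v) ≤
      (if u = v then Q.real (A v) else 0) + Q.real (A u) * Q.real (A v) / (1 - η) := by
    rcases eq_or_ne u v with rfl | huv
    · simpa using div_nonneg (mul_self_nonneg (Q.real (A u))) hη'.le
    · rw [if_neg huv, zero_add, le_div_iff₀' hη']
      exact hpair u v huv
  refine (Finset.sum_le_sum fun u _ => Finset.sum_le_sum fun v _ => hterm u v).trans_eq ?_
  simp only [Finset.sum_add_distrib, ← Finset.sum_div, ← Finset.mul_sum, ← Finset.sum_mul,
    Finset.sum_ite_eq, Finset.mem_univ, if_true, sq]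

theorem one_sub_sub_le_measureReal_iUnion [IsFiniteMeasure Q] (hA : ∀ v, MeasurableSet (A v))
    {η : ℝ} (hη0 : 0 ≤ η) (hη1 : η < 1)
    (hpair : ∀ u v, u ≠ v → (1 - η) * Q.real (A u ∩ A v) ≤ Q.real (A u) * Q.real (A v))
    (hE : 0 < ∑ v, Q.real (A v)) :
    1 - η - 1 / ∑ v, Q.real (A v) ≤ Q.real (⋃ v, A v) := by
  have hη : 0 < 1 - η := sub_pos.2 hη1
  have h := (sq_sum_measureReal_le_mul_measureReal_iUnion hA).trans
    (mul_le_mul_of_nonneg_right (sum_sum_measureReal_inter_le hη1 hpair) measureReal_nonneg)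
  set E := ∑ v, Q.real (A v)
  have hratio : E * (1 - η) ≤ (1 - η + E) * Q.real (⋃ v, A v) := by
    rw [← mul_le_mul_iff_right₀ (show 0 < E / (1 - η) by positivity)]
    convert h using 1 <;> field_simp
  rw [← mul_le_mul_iff_right₀ (show 0 < 1 - η + E by positivity)]
  refine le_trans ?_ hratio
  have hE' : E * (1 / E) = 1 := mul_one_div_cancel hE.ne'
  have : 0 < 1 / E := by positivity
  nlinarith [mul_nonneg hη.le this.le]

end SecondMoment

theorem measurableSet_setOf_forall_mem_lt {κ : Type*} (I : Finset κ) (s : κ → ℝ) :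
    MeasurableSet {x : κ → ℝ | ∀ i ∈ I, s i < x i} := by
  simp only [ofPred_forall]
  exact Finset.measurableSet_biInter I fun i _ =>
    measurableSet_lt measurable_const (measurable_pi_apply i)

namespace NegativelyCorrelated

variable {Ω κ : Type*} [MeasurableSpace Ω] {P : Measure Ω} {X : Ω → κ → ℝ}

theorem map (h : NegativelyCorrelated P X) (hX : AEMeasurable X P) :
    NegativelyCorrelated (P.map X) id := by
  intro I J hIJ s t hs ht
  have hmeas (I : Finset κ) (s : κ → ℝ) : MeasurableSet {x : κ → ℝ | ∀ i ∈ I, s i < |x i|} := by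
    simp only [ofPred_forall]
    exact Finset.measurableSet_biInter I fun i _ =>
      measurableSet_lt measurable_const (measurable_pi_apply i).abs
  have hI := map_measureReal_apply_of_aemeasurable hX (hmeas I s)
  have hJ := map_measureReal_apply_of_aemeasurable hX (hmeas J t)
  have hIJ' := map_measureReal_apply_of_aemeasurable hX ((hmeas I s).inter (hmeas J t))
  exact (hIJ'.trans_le (h I J hIJ s t hs ht)).trans_eq (congrArg₂ (· * ·) hI hJ).symm

theorem measureReal_and_le (h : NegativelyCorrelated P X) (hX : ∀ᵐ ω ∂P, 0 ≤ X ω)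
    {I J : Finset κ} (hIJ : Disjoint I J) {s : κ → ℝ} (hs : 0 ≤ s) :
    P.real {ω | (∀ i ∈ I, s i < X ω i) ∧ ∀ j ∈ J, s j < X ω j} ≤
      P.real {ω | ∀ i ∈ I, s i < X ω i} * P.real {ω | ∀ j ∈ J, s j < X ω j} := by
  have habs (I : Finset κ) :
      {ω | ∀ i ∈ I, s i < |X ω i|} =ᵐ[P] {ω | ∀ i ∈ I, s i < X ω i} := by
    filter_upwards [hX] with ω hω
    exact propext (forall₂_congr fun i _ => by rw [abs_of_nonneg (hω i)])
  have hI := measureReal_congr (habs I)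
  have hJ := measureReal_congr (habs J)
  have hIJ' := measureReal_congr ((habs I).inter (habs J))
  rw [← hI, ← hJ]
  exact hIJ'.symm.trans_le (h I J hIJ s s (fun i _ => hs i) fun j _ => hs j)

theorem measureReal_le_prod [IsProbabilityMeasure P] (h : NegativelyCorrelated P X)
    (hX : ∀ᵐ ω ∂P, 0 ≤ X ω) (I : Finset κ) {s : κ → ℝ} (hs : 0 ≤ s) :
    P.real {ω | ∀ i ∈ I, s i < X ω i} ≤ ∏ i ∈ I, P.real {ω | s i < X ω i} := by
  classical
  induction I using Finset.induction_on with
  | empty => simp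
  | insert e I he ih =>
    have hsplit := h.measureReal_and_le hX (Finset.disjoint_singleton_left.2 he) hs
    simp only [Finset.mem_singleton, forall_eq] at hsplit
    simp only [Finset.forall_mem_insert, Finset.prod_insert he]
    exact hsplit.trans (mul_le_mul_of_nonneg_left ih measureReal_nonneg)

end NegativelyCorrelated

section Graph

variable {n : ℕ}

/-- The pairs containing the vertex `v`: it is isolated iff none of them is an edge. -/
def starPairs (v : Fin n) : Finset (VertexPair n) :=
  {e | e.1.1 = v ∨ e.1.2 = v}

/-- The pairs with exactly one endpoint in `S`, the potential edges across the cut `(S, Sᶜ)`. -/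
def cutPairs (S : Finset (Fin n)) : Finset (VertexPair n) :=
  {e | ¬(e.1.1 ∈ S ↔ e.1.2 ∈ S)}

theorem mem_starPairs {v : Fin n} {e : VertexPair n} :
    e ∈ starPairs v ↔ e.1.1 = v ∨ e.1.2 = v := by
  simp [starPairs]

theorem mem_cutPairs {S : Finset (Fin n)} {e : VertexPair n} :
    e ∈ cutPairs S ↔ ¬(e.1.1 ∈ S ↔ e.1.2 ∈ S) := by
  simp [cutPairs]

theorem cutPairs_compl (S : Finset (Fin n)) : cutPairs Sᶜ = cutPairs S := by
  ext e
  simp only [mem_cutPairs, Finset.mem_compl, not_iff_not]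

theorem cutPairs_singleton (v : Fin n) : cutPairs {v} = starPairs v := by
  ext ⟨⟨a, b⟩, hab⟩
  simp only [mem_cutPairs, mem_starPairs, Finset.mem_singleton]
  grind

theorem card_cutPairs (S : Finset (Fin n)) : (cutPairs S).card = S.card * (n - S.card) := by
  have hprod : (S ×ˢ Sᶜ).card = S.card * (n - S.card) := by
    rw [Finset.card_product, Finset.card_compl, Fintype.card_fin]
  rw [← hprod]
  refine Finset.card_nbij (fun e => if e.1.1 ∈ S then e.1 else e.1.swap) ?_ ?_ ?_
  · intro e he
    simp only [Finset.mem_coe, Finset.mem_product, Finset.mem_compl, mem_cutPairs] at he ⊢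
    grind
  · rintro ⟨⟨a, b⟩, hab⟩ he ⟨⟨c, d⟩, hcd⟩ he' h
    simp only [Finset.mem_coe, mem_cutPairs] at he he' h
    simp only [Subtype.mk.injEq, Prod.mk.injEq]
    grind
  · rintro ⟨i, j⟩ hij
    obtain ⟨hi, hj⟩ : i ∈ S ∧ j ∉ S := by simpa using hij
    rcases lt_or_gt_of_ne (ne_of_mem_of_not_mem hi hj) with hlt | hlt
    · exact ⟨⟨(i, j), hlt⟩, by simp [mem_cutPairs, hi, hj], by simp [hi]⟩
    · exact ⟨⟨(j, i), hlt⟩, by simp [mem_cutPairs, hi, hj], by simp [hj]⟩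

theorem card_starPairs (v : Fin n) : (starPairs v).card = n - 1 := by
  rw [← cutPairs_singleton, card_cutPairs, Finset.card_singleton, one_mul]

theorem exists_starPairs_sdiff_eq_erase {u v : Fin n} (huv : u ≠ v) :
    ∃ e ∈ starPairs v, starPairs v \ starPairs u = (starPairs v).erase e := by
  obtain ⟨e, heu, hev⟩ : ∃ e, e ∈ starPairs u ∧ e ∈ starPairs v := by
    simp only [mem_starPairs]
    rcases lt_or_gt_of_ne huv with hlt | hlt
    exacts [⟨⟨(u, v), hlt⟩, .inl rfl, .inr rfl⟩, ⟨⟨(v, u), hlt⟩, .inr rfl, .inl rfl⟩]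
  refine ⟨e, hev, ?_⟩
  obtain ⟨⟨a, b⟩, hab⟩ := e
  ext ⟨⟨c, d⟩, hcd⟩
  simp only [Finset.mem_sdiff, Finset.mem_erase, mem_starPairs, ne_eq, Subtype.mk.injEq,
    Prod.mk.injEq] at heu hev ⊢
  grind

theorem isIsolated_thresholdGraph {x : VertexPair n → ℝ} {p : ℝ} {v : Fin n}
    (h : ∀ e ∈ starPairs v, p < x e) : (thresholdGraph x p).IsIsolated v := by
  intro w hw
  rw [thresholdGraph, SimpleGraph.fromRel_adj] at hw
  rcases hw.2 with ⟨hlt, hx⟩ | ⟨hlt, hx⟩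
  · exact (h _ (mem_starPairs.2 (.inl rfl))).not_ge hx
  · exact (h _ (mem_starPairs.2 (.inr rfl))).not_ge hx

theorem thresholdGraph_adj_of_le {x : VertexPair n → ℝ} {p : ℝ} {e : VertexPair n}
    (h : x e ≤ p) : (thresholdGraph x p).Adj e.1.1 e.1.2 := by
  rw [thresholdGraph, SimpleGraph.fromRel_adj]
  exact ⟨e.2.ne, .inl ⟨e.2, h⟩⟩

/-- The smaller sides of the nontrivial cuts of the vertex set. -/
def smallSides (n : ℕ) : Finset (Finset (Fin n)) :=
  {S | S.Nonempty ∧ 2 * S.card ≤ n}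

theorem mem_smallSides {S : Finset (Fin n)} :
    S ∈ smallSides n ↔ S.Nonempty ∧ 2 * S.card ≤ n := by
  simp [smallSides]

theorem exists_cut_of_not_connected [NeZero n] {x : VertexPair n → ℝ} {p : ℝ}
    (h : ¬(thresholdGraph x p).Connected) :
    ∃ S ∈ smallSides n, ∀ e ∈ cutPairs S, p < x e := by
  classical
  obtain ⟨u, v, huv⟩ : ∃ u v, ¬(thresholdGraph x p).Reachable u v := by
    by_contra! hreach
    exact h ⟨hreach⟩
  set S : Finset (Fin n) := {w | (thresholdGraph x p).Reachable u w}
  have hmem (w : Fin n) : w ∈ S ↔ (thresholdGraph x p).Reachable u w := by simp [S]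
  have hcut : ∀ e ∈ cutPairs S, p < x e := by
    intro e he
    by_contra! hle
    have hadj := thresholdGraph_adj_of_le hle
    rw [mem_cutPairs, hmem, hmem] at he
    exact he ⟨fun hr => hr.trans hadj.reachable, fun hr => hr.trans hadj.symm.reachable⟩
  have hu : u ∈ S := (hmem u).2 (.refl u)
  have hv : v ∉ S := fun hv => huv ((hmem v).1 hv)
  rcases le_or_gt (2 * S.card) n with hle | hgt
  · exact ⟨S, mem_smallSides.2 ⟨⟨u, hu⟩, hle⟩, hcut⟩
  · refine ⟨Sᶜ, mem_smallSides.2 ⟨⟨v, Finset.mem_compl.2 hv⟩, ?_⟩, (cutPairs_compl S).symm ▸ hcut⟩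
    rw [Finset.card_compl, Fintype.card_fin]
    omega

theorem sum_pow_card_smallSides_le (n : ℕ) {y : ℝ} (hy : 0 ≤ y) :
    ∑ S ∈ smallSides n, y ^ S.card ≤ (1 + y) ^ n - 1 := by
  have hbinom : ∑ S : Finset (Fin n), y ^ S.card = (1 + y) ^ n := by
    simpa [add_comm] using Fintype.sum_pow_mul_eq_add_pow (Fin n) y 1
  rw [← hbinom, ← Finset.sum_erase_add _ _ (Finset.mem_univ ∅), Finset.card_empty, pow_zero,
    add_sub_cancel_right]
  refine Finset.sum_le_sum_of_subset_of_nonneg (fun S hS => ?_) fun _ _ _ => by positivity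
  exact Finset.mem_erase.2 ⟨(mem_smallSides.1 hS).1.ne_empty, Finset.mem_univ S⟩

end Graph

section SecondMomentOfCoordinates

variable {Ω ι : Type*} [MeasurableSpace Ω] [Finite ι] {P : Measure Ω} {X : Ω → ι → ℝ}

theorem sq_sigmaMin_le (e : ι) : sigmaMin P X ^ 2 ≤ ∫ ω, X ω e ^ 2 ∂P := by
  rw [sigmaMin, Real.sq_sqrt (Real.iInf_nonneg fun e => integral_nonneg fun ω => sq_nonneg _)]
  exact ciInf_le (finite_range _).bddBelow e

theorem le_sq_sigmaMax (e : ι) : ∫ ω, X ω e ^ 2 ∂P ≤ sigmaMax P X ^ 2 := by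
  rw [sigmaMax, Real.sq_sqrt (Real.iSup_nonneg fun e => integral_nonneg fun ω => sq_nonneg _)]
  exact le_ciSup (f := fun e => ∫ ω, X ω e ^ 2 ∂P) (finite_range _).bddAbove e

theorem sigmaMin_pos [Nonempty ι] (h : ∀ e, 0 < ∫ ω, X ω e ^ 2 ∂P) : 0 < sigmaMin P X := by
  obtain ⟨e, he⟩ := exists_eq_ciInf_of_finite (f := fun e => ∫ ω, X ω e ^ 2 ∂P)
  exact Real.sqrt_pos.2 (he ▸ h e)

theorem sigmaMax_pos [Nonempty ι] (h : ∀ e, 0 < ∫ ω, X ω e ^ 2 ∂P) : 0 < sigmaMax P X := by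
  obtain ⟨e⟩ := ‹Nonempty ι›
  exact Real.sqrt_pos.2 ((h e).trans_le
    (le_ciSup (f := fun e => ∫ ω, X ω e ^ 2 ∂P) (finite_range _).bddAbove e))

end SecondMomentOfCoordinates

theorem measureReal_map_le_of_preimage_subset {Ω α : Type*} [MeasurableSpace Ω]
    [MeasurableSpace α] {P : Measure Ω} [IsFiniteMeasure P] {X : Ω → α} (hX : AEMeasurable X P)
    {B : Set α} (hB : MeasurableSet B) {S : Set Ω} (h : X ⁻¹' B ⊆ S) :
    (P.map X).real B ≤ P.real S :=
  (map_measureReal_apply_of_aemeasurable hX hB).trans_le (measureReal_mono h)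

theorem integral_sq_map {Ω ι : Type*} [MeasurableSpace Ω] {P : Measure Ω} {X : Ω → ι → ℝ}
    (hX : AEMeasurable X P) (e : ι) : ∫ x, x e ^ 2 ∂P.map X = ∫ ω, X ω e ^ 2 ∂P :=
  integral_map hX ((measurable_pi_apply e).pow_const 2).aestronglyMeasurable

theorem nonempty_vertexPair {n : ℕ} (hn : 2 ≤ n) : Nonempty (VertexPair n) :=
  ⟨⟨(⟨0, by lia⟩, ⟨1, by lia⟩), Fin.mk_lt_mk.2 one_pos⟩⟩

theorem div_eight_mul_le_rpow_neg {x δ : ℝ} (hx : 1 ≤ x) (hδ : δ < 1) :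
    (1 - δ) / 2 * (Real.log x / x) / 8 * (4 * ((1 - δ) / 2 * (Real.log x / x)) * x + 1) ≤
      5 / 8 * x ^ (-δ) := by
  have hx0 : 0 < x := by linarith
  set r := (1 - δ) / 2 with hr
  have hr0 : 0 < r := by linarith
  have hlog : r * Real.log x ≤ x ^ r := by
    rw [mul_comm, ← le_div_iff₀ hr0]
    exact Real.log_le_rpow_div hx0.le hr0
  have hlog0 : 0 ≤ Real.log x := Real.log_nonneg hx
  have hone : 1 ≤ x ^ r := Real.one_le_rpow hx hr0.le
  calc r * (Real.log x / x) / 8 * (4 * (r * (Real.log x / x)) * x + 1)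
      = r * Real.log x / x / 8 * (4 * (r * Real.log x) + 1) := by field_simp
    _ ≤ x ^ r / x / 8 * (5 * x ^ r) := by
        gcongr
        linarith
    _ = 5 / 8 * (x ^ r * x ^ r / x) := by ring
    _ = 5 / 8 * x ^ (-δ) := by
        rw [← Real.rpow_add hx0, ← Real.rpow_sub_one hx0.ne', hr]
        ring_nf

section RandomGraph

variable {n : ℕ} {Q : Measure (VertexPair n → ℝ)} [IsProbabilityMeasure Q]

namespace LogConcaveAntitoneLaw

theorem measureReal_cut_le (hQ : LogConcaveAntitoneLaw Q) (hNC : NegativelyCorrelated Q id)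
    {σ : ℝ} (hσ : 0 < σ) (hσe : ∀ e, ∫ x, x e ^ 2 ∂Q ≤ σ ^ 2) {s : ℝ} (hs : 0 < s)
    {S : Finset (Fin n)} (hS : S ∈ smallSides n) :
    Q.real {x | ∀ e ∈ cutPairs S, s < x e} ≤ Real.exp (-(s * n / (8 * σ))) ^ S.card := by
  have hcard : (S.card : ℝ) * (n / 2) ≤ (cutPairs S).card := by
    have hS2 : 2 * (S.card : ℝ) ≤ n := mod_cast (mem_smallSides.1 hS).2
    rw [card_cutPairs, Nat.cast_mul, Nat.cast_sub (by linarith [(mem_smallSides.1 hS).2])]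
    gcongr
    linarith
  calc Q.real {x | ∀ e ∈ cutPairs S, s < x e}
      ≤ ∏ e ∈ cutPairs S, Q.real {x | s < x e} :=
        hNC.measureReal_le_prod (hQ.ae_pos.mono fun x hx e => (hx e).le) (cutPairs S)
          (s := fun _ => s) fun _ => hs.le
    _ ≤ ∏ e ∈ cutPairs S, Real.exp (-(s / (4 * σ))) :=
        Finset.prod_le_prod (fun _ _ => measureReal_nonneg) fun e _ =>
          hQ.measureReal_lt_le_exp hσ (hσe e) hs
    _ = Real.exp (-(s / (4 * σ) * (cutPairs S).card)) := by
        rw [Finset.prod_const, ← Real.exp_nat_mul]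
        ring_nf
    _ ≤ Real.exp (-(s / (4 * σ) * (S.card * (n / 2)))) := by gcongr
    _ = Real.exp (-(s * n / (8 * σ))) ^ S.card := by
        rw [← Real.exp_nat_mul]
        ring_nf

theorem measureReal_iUnion_cut_le (hQ : LogConcaveAntitoneLaw Q)
    (hNC : NegativelyCorrelated Q id) {σ : ℝ} (hσ : 0 < σ)
    (hσe : ∀ e, ∫ x, x e ^ 2 ∂Q ≤ σ ^ 2) {s : ℝ} (hs : 0 < s)
    (hsmall : n * Real.exp (-(s * n / (8 * σ))) ≤ 1) :
    Q.real (⋃ S ∈ smallSides n, {x | ∀ e ∈ cutPairs S, s < x e}) ≤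
      2 * (n * Real.exp (-(s * n / (8 * σ)))) := by
  set y := Real.exp (-(s * n / (8 * σ)))
  have hy : 0 ≤ n * y := by positivity
  have hexp := (le_abs_self _).trans
    (Real.abs_exp_sub_one_le (x := n * y) ((abs_of_nonneg hy).trans_le hsmall))
  rw [abs_of_nonneg hy] at hexp
  calc Q.real (⋃ S ∈ smallSides n, {x | ∀ e ∈ cutPairs S, s < x e})
      ≤ ∑ S ∈ smallSides n, Q.real {x | ∀ e ∈ cutPairs S, s < x e} :=
        measureReal_biUnion_finset_le _ _
    _ ≤ ∑ S ∈ smallSides n, y ^ S.card :=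
        Finset.sum_le_sum fun S hS => hQ.measureReal_cut_le hNC hσ hσe hs hS
    _ ≤ (1 + y) ^ n - 1 := sum_pow_card_smallSides_le n (by positivity)
    _ ≤ Real.exp y ^ n - 1 := by
        gcongr
        linarith [Real.add_one_le_exp y]
    _ = Real.exp (n * y) - 1 := by rw [Real.exp_nat_mul]
    _ ≤ 2 * (n * y) := hexp

theorem one_sub_mul_measureReal_star_inter_le (hQ : LogConcaveAntitoneLaw Q)
    (hNC : NegativelyCorrelated Q id) {s : ℝ} (hs : 0 < s)
    (hhalf : ∀ e, 1 / 2 ≤ Q.real {x | s < x e}) {t : ℝ} (ht0 : 0 < t) (ht : t < 1 / 2)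
    {u v : Fin n} (huv : u ≠ v) :
    (1 - t / 8 * (4 * t * n + 1)) * Q.real ({x | ∀ e ∈ starPairs u, t * s / 16 < x e} ∩
        {x | ∀ e ∈ starPairs v, t * s / 16 < x e}) ≤
      Q.real {x | ∀ e ∈ starPairs u, t * s / 16 < x e} *
        Q.real {x | ∀ e ∈ starPairs v, t * s / 16 < x e} := by
  set p := t * s / 16
  rcases le_total (1 - t / 8 * (4 * t * n + 1)) 0 with hη | hη
  · exact (mul_nonpos_of_nonpos_of_nonneg hη measureReal_nonneg).trans
      (mul_nonneg measureReal_nonneg measureReal_nonneg)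
  obtain ⟨e, he, hsdiff⟩ := exists_starPairs_sdiff_eq_erase huv
  have hp : 0 ≤ p := by positivity
  have hcorr : Q.real ({x | ∀ e ∈ starPairs u, p < x e} ∩ {x | ∀ e ∈ starPairs v, p < x e}) ≤
      Q.real {x | ∀ i ∈ starPairs u, p < x i} *
        Q.real {x | ∀ i ∈ (starPairs v).erase e, p < x i} := by
    rw [← hsdiff]
    refine (measureReal_mono ?_).trans (hNC.measureReal_and_le
      (hQ.ae_pos.mono fun x hx e => (hx e).le) Finset.disjoint_sdiff (s := fun _ => p) fun _ => hp)
    exact fun x hx => ⟨hx.1, fun j hj => hx.2 j (Finset.mem_sdiff.1 hj).1⟩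
  have herase : (1 - t / 8 * (4 * t * n + 1)) *
      Q.real {x | ∀ i ∈ (starPairs v).erase e, p < x i} ≤
        Q.real {x | ∀ i ∈ starPairs v, p < x i} := by
    refine le_trans ?_ (hQ.one_sub_mul_measureReal_erase_le he hs (fun i _ => hhalf i) ht0 ht)
    gcongr
    exact (card_starPairs v).trans_le (Nat.sub_le n 1)
  calc _ ≤ _ := mul_le_mul_of_nonneg_left hcorr hη
    _ = Q.real {x | ∀ i ∈ starPairs u, p < x i} * ((1 - t / 8 * (4 * t * n + 1)) *
        Q.real {x | ∀ i ∈ (starPairs v).erase e, p < x i}) := mul_left_comm _ _ _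
    _ ≤ _ := mul_le_mul_of_nonneg_left herase measureReal_nonneg

theorem mul_exp_le_sum_measureReal_star (hQ : LogConcaveAntitoneLaw Q) {s : ℝ} (hs : 0 < s)
    (hhalf : ∀ e, 1 / 2 ≤ Q.real {x | s < x e}) {t : ℝ} (ht0 : 0 < t) (ht1 : t < 1) :
    n * Real.exp (-(2 * t * n)) ≤
      ∑ v : Fin n, Q.real {x | ∀ e ∈ starPairs v, t * s / 16 < x e} := by
  have hstar (v : Fin n) :
      Real.exp (-(2 * t * n)) ≤ Q.real {x | ∀ e ∈ starPairs v, t * s / 16 < x e} := by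
    convert hQ.exp_le_measureReal_forall_mem_lt (I := starPairs v) hs (fun e _ => hhalf e) ht0 ht1
    rw [card_starPairs, Nat.cast_pred (Fin.pos v), sub_add_cancel]
  simpa using Finset.sum_le_sum fun v (_ : v ∈ Finset.univ) => hstar v

theorem one_sub_sub_le_measureReal_iUnion_star [NeZero n] (hQ : LogConcaveAntitoneLaw Q)
    (hNC : NegativelyCorrelated Q id) {s : ℝ} (hs : 0 < s)
    (hhalf : ∀ e, 1 / 2 ≤ Q.real {x | s < x e}) {t : ℝ} (ht0 : 0 < t) (ht : t < 1 / 2)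
    (hη : t / 8 * (4 * t * n + 1) < 1) :
    1 - t / 8 * (4 * t * n + 1) - Real.exp (2 * t * n) / n ≤
      Q.real (⋃ v : Fin n, {x | ∀ e ∈ starPairs v, t * s / 16 < x e}) := by
  have hn : 0 < n * Real.exp (-(2 * t * n)) := by
    have := NeZero.pos n
    positivity
  have hsum := hQ.mul_exp_le_sum_measureReal_star hs hhalf ht0 (by linarith)
  have hinv : Real.exp (2 * t * n) / n = 1 / (n * Real.exp (-(2 * t * n))) := by
    rw [Real.exp_neg]
    field_simp
  rw [hinv]
  refine le_trans ?_ (one_sub_sub_le_measureReal_iUnion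
    (fun v => measurableSet_setOf_forall_mem_lt (starPairs v) fun _ => t * s / 16) (by positivity)
    hη (fun u v huv => hQ.one_sub_mul_measureReal_star_inter_le hNC hs hhalf ht0 ht huv)
    (hn.trans_le hsum))
  gcongr

theorem measureReal_iUnion_cut_le_rpow (hQ : LogConcaveAntitoneLaw Q)
    (hNC : NegativelyCorrelated Q id) (hn : 2 ≤ n) {δ : ℝ} (hδ : 0 < δ) {σ : ℝ} (hσ : 0 < σ)
    (hσe : ∀ e, ∫ x, x e ^ 2 ∂Q ≤ σ ^ 2) :
    Q.real (⋃ S ∈ smallSides n,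
      {x | ∀ e ∈ cutPairs S, 8 * (1 + δ) * σ * (Real.log n / n) < x e}) ≤
        2 * (n : ℝ) ^ (-δ) := by
  have hn2 : (2 : ℝ) ≤ n := mod_cast hn
  have hlog : 0 < Real.log n := Real.log_pos (by linarith)
  set s := 8 * (1 + δ) * σ * (Real.log n / n) with hs
  have hrate : s * n / (8 * σ) = Real.log n * (1 + δ) := by
    rw [hs]
    field_simp
  have hpow : n * Real.exp (-(s * n / (8 * σ))) = (n : ℝ) ^ (-δ) := by
    rw [hrate, ← mul_neg, ← Real.rpow_def_of_pos (by positivity),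
      ← Real.rpow_one_add' (by positivity) (by linarith)]
    ring_nf
  rw [← hpow]
  refine hQ.measureReal_iUnion_cut_le hNC hσ hσe (by positivity) ?_
  rw [hpow]
  exact Real.rpow_le_one_of_one_le_of_nonpos (by linarith) (by linarith)

theorem one_sub_lt_measureReal_iUnion_star (hQ : LogConcaveAntitoneLaw Q)
    (hNC : NegativelyCorrelated Q id) (hn : 2 ≤ n) {δ : ℝ} (hδ0 : 0 < δ) (hδ1 : δ < 1) {σ : ℝ}
    (hσ : 0 < σ) (hσe : ∀ e, σ ^ 2 ≤ ∫ x, x e ^ 2 ∂Q) :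
    1 - 2 * (n : ℝ) ^ (-δ) < Q.real (⋃ v : Fin n,
      {x | ∀ e ∈ starPairs v, (1 - δ) / 128 * σ * (Real.log n / n) < x e}) := by
  have : NeZero n := ⟨by lia⟩
  have hn2 : (2 : ℝ) ≤ n := mod_cast hn
  have hlog : 0 < Real.log n := Real.log_pos (by linarith)
  have hlogn : Real.log n / n < 1 :=
    (div_lt_one (by positivity)).2 (by linarith [Real.log_le_sub_one_of_pos (show 0 < (n : ℝ) by
      positivity)])
  have hδ : 0 < 1 - δ := sub_pos.2 hδ1
  set t := (1 - δ) / 2 * (Real.log n / n) with ht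
  have ht0 : 0 < t := by positivity
  have ht2 : t < 1 / 2 := by nlinarith
  have hη : t / 8 * (4 * t * n + 1) ≤ 5 / 8 * (n : ℝ) ^ (-δ) :=
    div_eight_mul_le_rpow_neg (by linarith) hδ1
  have hpow : Real.exp (2 * t * n) / n = (n : ℝ) ^ (-δ) := by
    rw [show 2 * t * n = Real.log n * (1 - δ) by rw [ht]; field_simp,
      ← Real.rpow_def_of_pos (by positivity), ← Real.rpow_sub_one (by positivity)]
    ring_nf
  have hpow1 : (n : ℝ) ^ (-δ) ≤ 1 :=
    Real.rpow_le_one_of_one_le_of_nonpos (by linarith) (by linarith)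
  have hpow0 : 0 < (n : ℝ) ^ (-δ) := by positivity
  have h := hQ.one_sub_sub_le_measureReal_iUnion_star hNC (div_pos hσ four_pos)
    (fun e => hQ.half_le_measureReal_lt hσ (hσe e)) ht0 ht2 (by linarith)
  rw [show t * (σ / 4) / 16 = (1 - δ) / 128 * σ * (Real.log n / n) by rw [ht]; ring, hpow] at h
  linarith

end LogConcaveAntitoneLaw

variable {Ω : Type*} [MeasurableSpace Ω] {P : Measure Ω} [IsProbabilityMeasure P]
  {X : Ω → VertexPair n → ℝ}

theorem one_sub_lt_measureReal_hasIsolatedVertex (hX : HasLogConcaveDownMonotoneDensity P X)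
    (hNC : NegativelyCorrelated P X) (hn : 2 ≤ n) {δ : ℝ} (hδ0 : 0 < δ) (hδ1 : δ < 1) {p : ℝ}
    (hp : p < (1 - δ) / 128 * sigmaMin P X * (Real.log n / n)) :
    1 - 2 * (n : ℝ) ^ (-δ) < P.real {ω | HasIsolatedVertex (thresholdGraph (X ω) p)} := by
  have := Measure.isProbabilityMeasure_map (μ := P) hX.1
  have := nonempty_vertexPair hn
  have hQ := hX.logConcaveAntitoneLaw_map
  have hsq := integral_sq_map hX.1
  have hσ : 0 < sigmaMin P X := sigmaMin_pos fun e => hsq e ▸ hQ.integral_sq_pos e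
  have hstar := hQ.one_sub_lt_measureReal_iUnion_star (hNC.map hX.1) hn hδ0 hδ1 hσ
    fun e => hsq e ▸ sq_sigmaMin_le e
  refine hstar.trans_le (measureReal_map_le_of_preimage_subset hX.1
    (.iUnion fun v => measurableSet_setOf_forall_mem_lt _ _) fun ω hω => ?_)
  obtain ⟨v, hv⟩ := mem_iUnion.1 hω
  exact ⟨v, isIsolated_thresholdGraph fun e he => hp.trans (hv e he)⟩

theorem one_sub_lt_measureReal_connected (hX : HasLogConcaveDownMonotoneDensity P X)
    (hNC : NegativelyCorrelated P X) (hn : 2 ≤ n) {δ : ℝ} (hδ : 0 < δ) {p : ℝ}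
    (hp : 8 * (1 + δ) * sigmaMax P X * (Real.log n / n) < p) :
    1 - 3 * (n : ℝ) ^ (-δ) < P.real {ω | (thresholdGraph (X ω) p).Connected} := by
  have : NeZero n := ⟨by lia⟩
  have := Measure.isProbabilityMeasure_map (μ := P) hX.1
  have := nonempty_vertexPair hn
  have hQ := hX.logConcaveAntitoneLaw_map
  have hsq := integral_sq_map hX.1
  have hσ : 0 < sigmaMax P X := sigmaMax_pos fun e => hsq e ▸ hQ.integral_sq_pos e
  have hcut := hQ.measureReal_iUnion_cut_le_rpow (hNC.map hX.1) hn hδ hσ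
    fun e => hsq e ▸ le_sq_sigmaMax e
  set U : Set (VertexPair n → ℝ) := ⋃ S ∈ smallSides n,
    {x | ∀ e ∈ cutPairs S, 8 * (1 + δ) * sigmaMax P X * (Real.log n / n) < x e}
  have hU : MeasurableSet U :=
    Finset.measurableSet_biUnion _ fun S _ => measurableSet_setOf_forall_mem_lt (cutPairs S) _
  have hconn : (P.map X).real Uᶜ ≤ P.real {ω | (thresholdGraph (X ω) p).Connected} := by
    refine measureReal_map_le_of_preimage_subset hX.1 hU.compl fun ω hω => ?_
    by_contra hnot
    obtain ⟨S, hS, hSp⟩ := exists_cut_of_not_connected hnot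
    exact hω (mem_iUnion₂.2 ⟨S, hS, fun e he => hp.trans (hSp e he)⟩)
  rw [probReal_compl_eq_one_sub hU] at hconn
  have : 0 < (n : ℝ) ^ (-δ) := by positivity
  linarith

theorem theorem1_general (hX : HasLogConcaveDownMonotoneDensity P X)
    (hNC : NegativelyCorrelated P X) (hn : 2 ≤ n) {δ : ℝ} (hδ : 0 < δ) {p : ℝ} :
    (δ < 1 → p < (1 - δ) / 128 * sigmaMin P X * (Real.log n / n) →
      P.real {ω | HasIsolatedVertex (thresholdGraph (X ω) p)} > 1 - 2 * (n : ℝ) ^ (-δ)) ∧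
    (p > 8 * (1 + δ) * sigmaMax P X * (Real.log n / n) →
      P.real {ω | (thresholdGraph (X ω) p).Connected} > 1 - 3 * (n : ℝ) ^ (-δ)) :=
  ⟨fun hδ1 => one_sub_lt_measureReal_hasIsolatedVertex hX hNC hn hδ hδ1,
    one_sub_lt_measureReal_connected hX hNC hn hδ⟩

end RandomGraph

theorem theorem1 (δ : ℝ) (hδ0 : 0 < δ) (hδ1 : δ < 1) :
    (∃ c₁ : ℝ, 0 < c₁ ∧ ∃ c₂ : ℝ, 0 < c₂ ∧
      ∀ (n : ℕ), 2 ≤ n → ∀ (Ω : Type*) [MeasurableSpace Ω] (P : Measure Ω) [IsProbabilityMeasure P]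
        (X : Ω → VertexPair n → ℝ), HasLogConcaveDownMonotoneDensity P X →
        NegativelyCorrelated P X → ∀ p : ℝ, p < c₁ * sigmaMin P X * (Real.log n / n) →
        P.real {ω | HasIsolatedVertex (thresholdGraph (X ω) p)} > 1 - c₂ * (n : ℝ) ^ (-δ)) ∧
    (∃ C₁ : ℝ, 0 < C₁ ∧ ∃ C₂ : ℝ, 0 < C₂ ∧
      ∀ (n : ℕ), 2 ≤ n → ∀ (Ω : Type*) [MeasurableSpace Ω] (P : Measure Ω) [IsProbabilityMeasure P]
        (X : Ω → VertexPair n → ℝ), HasLogConcaveDownMonotoneDensity P X →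
        NegativelyCorrelated P X → ∀ p : ℝ, p > C₁ * sigmaMax P X * (Real.log n / n) →
        P.real {ω | (thresholdGraph (X ω) p).Connected} > 1 - C₂ * (n : ℝ) ^ (-δ)) :=
  ⟨⟨(1 - δ) / 128, by linarith, 2, two_pos, fun _ hn _ _ _ _ _ hX hNC _ =>
      (theorem1_general hX hNC hn hδ0).1 hδ1⟩,
    ⟨8 * (1 + δ), by linarith, 3, three_pos, fun _ hn _ _ _ _ _ hX hNC _ =>
      (theorem1_general hX hNC hn hδ0).2⟩⟩
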